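/- Let $p>3$ be a prime and $s\ge 1$ an integer. For rational $x$ and an integer $k\ge 0$ write $(x)_k=x(x+1)\cdots(x+k-1)$, with $(x)_0=1$, and put $H_m^{(2)}=\sum_{i=1}^m \frac{1}{i^2}$. Then $$\sum_{\substack{i,j\ge 0\\ i+j\le p^s-1}}(4i+1)(4j+1)\frac{(\frac12)_i^4(\frac12)_j^4}{(1)_i^4(1)_j^4}\equiv p^{2s}-\frac{p^{4s}}{2}H_{(p^s-1)/2}^{(2)}\pmod{p^{s+4}},$$ where for rational numbers $a,b$ and an integer $m\geq 1$ the congruence $a\equiv b\pmod m$ means that the numerator of $a-b$, in lowest terms, is divisible by $m$. -/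

import Mathlib

/-- The shifted factorial `(x)_k = x (x + 1) ⋯ (x + k - 1)` of a rational number,
with `(x)_0 = 1`. -/
noncomputable def shiftedFactorial (x : ℚ) (k : ℕ) : ℚ := (ascPochhammer ℚ k).eval x

/-- The harmonic numbers of order two, `H_m^{(2)} = ∑_{i=1}^m 1 / i ^ 2`. -/
def harmonicTwo (m : ℕ) : ℚ := ∑ i ∈ Finset.Icc 1 m, 1 / (i : ℚ) ^ 2

/-- Congruence of rational numbers modulo `m`: the numerator of `x - y`, written in lowest
terms, is divisible by `m` (so that the denominator of `x - y` is prime to `m`). -/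
def RatModEq (m : ℕ) (x y : ℚ) : Prop := (m : ℤ) ∣ (x - y).num

/-! The congruence is the value at q = 1 of divisibility by cyclotomic polynomials. Since Φ_{p^r}(1)
= p, an integer polynomial divisible by Φ_{p^r} for every r < s and by the fifth power of Φ_{p^s}
takes at 1 a value divisible by p^{(s-1)+5}. The polynomial used is the q-analogue of left side
minus right side, with (1/2)_k/k! replaced by (q;q²)_k/(q²;q²)_k and denominators cleared; at q = 1
the clearing factors are prime to p.

Put n = p^s = 2M+1. At a root of unity of odd order d > 1 dividing n, the single terms in each block
of length d are antisymmetric on the first (d+1)/2 indices and zero afterwards. Hence the double sum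
vanishes (`double_sum_root_of_unity_eq_zero`), which gives the simple factors Φ_{p^r}.

For the fifth power, work in ℚ[q] localized at Φ_n, with t = q^n - 1. Terms of index above M carry
t^4, and their total coefficient vanishes at the root of unity by a second antisymmetry; so modulo
Φ_n^5 the double sum is the square of the single sum over i ≤ M (`dvd_sum_triangle_sub_sq`). That
single sum is needed only modulo Φ_n^4, because it is itself divisible by Φ_n (`dvd_single_sum`).

To evaluate it, three of the four equal parameters are moved to 1+t, 1+ωt, 1+ω²t with ω a primitive
cube root of unity. As (1-y)^3 becomes (1-y)^3 + t^3, the orders t and t² are unchanged, and the t^3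
coefficient vanishes at the root of unity by antisymmetry. Because 1+t = q^n, the perturbed series
terminates and is summed by a ₆φ₅ formula. Expanding the product side to order t² gives Σ
q^{2j}/(1-q^{2j})², which becomes the harmonic sum at q = 1. -/

/-! ### A terminating very-well-poised summation and its cubic perturbation. -/

/-- The part of the very-well-poised summand depending on the two parameters with sum `U` and
product `V`. -/
def pairFactor {K : Type*} [Field K] (q U V : K) (k : ℕ) : K :=
  ∏ j ∈ Finset.range k, (1 - q ^ (2 * j + 1)) * (V - U * q ^ (2 * j + 1) + q ^ (4 * j + 2)) /
    ((1 - q ^ (2 * j + 2)) * (1 - U * q ^ (2 * j + 2) + V * q ^ (4 * j + 4)))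

/-- The part of the very-well-poised summand depending on the terminating parameter `w`. -/
def singleFactor {K : Type*} [Field K] (q w : K) (k : ℕ) : K :=
  ∏ j ∈ Finset.range k, (w - q ^ (2 * j + 1)) / (1 - w * q ^ (2 * j + 2))

theorem singleFactor_shift {K : Type*} [Field K] (q w : K)
    (hw : ∀ j : ℕ, 1 - w * q ^ (2 * j + 2) ≠ 0) (l : ℕ) :
    singleFactor q (w * q ^ 2) (l + 1) * (1 - w * q ^ (2 * l + 4)) * (1 - w * q ^ (2 * l + 2)) =
      singleFactor q w l * q ^ (2 * l + 1) * (w * q - 1) * (1 - w * q ^ 2) := by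
  induction l with
  | zero =>
    have h1 : 1 - w * q ^ 4 ≠ 0 := hw 1
    have e : singleFactor q (w * q ^ 2) 1 = (w * q ^ 2 - q) / (1 - w * q ^ 4) := by
      simp [singleFactor, mul_assoc, ← pow_add]
    have e' : singleFactor q w 0 = 1 := by simp [singleFactor]
    simp only [zero_add, mul_zero, pow_one]
    rw [e', e]
    field_simp
  | succ l ih =>
    have h1 := hw l
    have h2 := hw (l + 1)
    have h3 := hw (l + 2)
    have e : singleFactor q (w * q ^ 2) (l + 1 + 1) =
      singleFactor q (w * q ^ 2) (l + 1) *
        ((w * q ^ 2 - q ^ (2 * (l + 1) + 1)) / (1 - w * q ^ (2 * (l + 2) + 2))) := by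
      rw [singleFactor, Finset.prod_range_succ, ← singleFactor]; congr 3; ring
    have e' : singleFactor q w (l + 1) =
      singleFactor q w l * ((w - q ^ (2 * l + 1)) / (1 - w * q ^ (2 * l + 2))) := by
      rw [singleFactor, Finset.prod_range_succ, ← singleFactor]
    rw [e, e']
    have k1 : 1 - w * q ^ (2 * (l + 1) + 4) ≠ 0 := by convert h3 using 4; omega
    have k2 : 1 - w * q ^ (2 * l + 4) ≠ 0 := by convert h2 using 4; omega
    have ih' : singleFactor q (w * q ^ 2) (l + 1) =
      singleFactor q w l * q ^ (2 * l + 1) * (w * q - 1) * (1 - w * q ^ 2) /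
        ((1 - w * q ^ (2 * l + 4)) * (1 - w * q ^ (2 * l + 2))) := by
      rw [eq_div_iff (mul_ne_zero k2 h1), ← ih]; ring
    rw [ih']
    field_simp
    ring

/-- A contiguous relation in the style of Zeilberger: the right side is the telescoping certificate
for passing from w to w q². With w = q^(2m+1) this is the step m → m+1 of the summation formula. -/
theorem sum_pairFactor_singleFactor_telescope {K : Type*} [Field K] (q w U V : K)
    (hq : ∀ j : ℕ, 1 - q ^ (2 * j + 2) ≠ 0) (hw : ∀ j : ℕ, 1 - w * q ^ (2 * j + 2) ≠ 0) (l : ℕ)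
    (hD : ∀ j < l, 1 - U * q ^ (2 * j + 2) + V * q ^ (4 * j + 4) ≠ 0) :
    (1 - U * (w * q) + V * (w * q) ^ 2) * ∑ k ∈ Finset.range (l + 1),
        (1 - q ^ (4 * k + 1)) * pairFactor q U V k * singleFactor q (w * q ^ 2) k -
      (1 - w * q ^ 2) * (1 - V * w) * ∑ k ∈ Finset.range (l + 1),
        (1 - q ^ (4 * k + 1)) * pairFactor q U V k * singleFactor q w k =
      w * (1 - w * q ^ 2) * (1 - q ^ (2 * l + 1)) * (V - U * q ^ (2 * l + 1) + q ^ (4 * l + 2)) *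
        pairFactor q U V l * (singleFactor q w l / (1 - w * q ^ (2 * l + 2))) := by
  induction l with
  | zero =>
    have h0 := hw 0
    simp [pairFactor, singleFactor] at *
    field_simp
    ring
  | succ l ih =>
    have hs := singleFactor_shift q w hw l
    have h1 := hw l
    have h2 := hw (l + 1)
    have h3 := hq l
    have h4 := hD l (by omega)
    rw [Finset.sum_range_succ _ (l + 1), Finset.sum_range_succ _ (l + 1),
      mul_add _ _ (_ * _ * singleFactor _ _ _), mul_add _ _ (_ * _ * singleFactor _ _ _), add_sub_add_comm, ih (fun j hj => hD j (by omega))]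
    have e' : singleFactor q w (l + 1) =
      singleFactor q w l * ((w - q ^ (2 * l + 1)) / (1 - w * q ^ (2 * l + 2))) := by
      rw [singleFactor, Finset.prod_range_succ, ← singleFactor]
    have e : pairFactor q U V (l + 1) = pairFactor q U V l *
      ((1 - q ^ (2 * l + 1)) * (V - U * q ^ (2 * l + 1) + q ^ (4 * l + 2)) /
      ((1 - q ^ (2 * l + 2)) * (1 - U * q ^ (2 * l + 2) + V * q ^ (4 * l + 4)))) := by
      rw [pairFactor, Finset.prod_range_succ, ← pairFactor]
    have k2 : 1 - w * q ^ (2 * l + 4) ≠ 0 := by convert h2 using 4; omega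
    have ih' : singleFactor q (w * q ^ 2) (l + 1) =
      singleFactor q w l * q ^ (2 * l + 1) * (w * q - 1) * (1 - w * q ^ 2) /
        ((1 - w * q ^ (2 * l + 4)) * (1 - w * q ^ (2 * l + 2))) := by
      rw [eq_div_iff (mul_ne_zero k2 h1), ← hs]; ring
    rw [ih', e', e]
    -- A and B are common factors; what remains is a rational identity in x = q^(2l), q, w, U, V.
    generalize pairFactor q U V l = A
    generalize singleFactor q w l = B
    have p1 : q ^ (2 * l + 1) = q ^ (2 * l) * q := by ring
    have p2 : q ^ (2 * l + 2) = q ^ (2 * l) * q ^ 2 := by ring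
    have p3 : q ^ (2 * l + 4) = q ^ (2 * l) * q ^ 4 := by ring
    have p4 : q ^ (4 * l + 2) = (q ^ (2 * l)) ^ 2 * q ^ 2 := by ring
    have p5 : q ^ (4 * l + 4) = (q ^ (2 * l)) ^ 2 * q ^ 4 := by ring
    have p6 : q ^ (4 * (l + 1) + 1) = (q ^ (2 * l)) ^ 2 * q ^ 5 := by ring
    have p7 : q ^ (4 * (l + 1) + 2) = (q ^ (2 * l)) ^ 2 * q ^ 6 := by ring
    have p8 : q ^ (2 * (l + 1) + 2) = q ^ (2 * l) * q ^ 4 := by ring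
    have p9 : q ^ (2 * (l + 1) + 1) = q ^ (2 * l) * q ^ 3 := by ring
    rw [p2] at h1 h3
    rw [p2, p5] at h4
    rw [p3] at k2
    rw [p1, p2, p3, p4, p5, p6, p7, p8, p9]
    clear hs ih e e' ih' p1 p2 p3 p4 p5 p6 p7 p8 p9 hD hq hw h2
    generalize q ^ (2 * l) = x at *
    generalize ha1 : 1 - w * (x * q ^ 2) = a1 at *
    generalize ha2 : 1 - w * (x * q ^ 4) = a2 at *
    generalize ha3 : 1 - x * q ^ 2 = a3 at *
    generalize ha4 : 1 - U * (x * q ^ 2) + V * (x ^ 2 * q ^ 4) = a4 at *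
    generalize hb1 : V - U * (x * q) + x ^ 2 * q ^ 2 = b1 at *
    generalize hb2 : V - U * (x * q ^ 3) + x ^ 2 * q ^ 6 = b2 at *
    generalize hb3 : 1 - U * (w * q) + V * (w * q) ^ 2 = b3 at *
    field_simp
    subst ha1 ha2 ha3 ha4 hb1 hb2 hb3
    ring

/-- The terminating very-well-poised summation: a `₆φ₅` with base `q²`, leading parameter `q`,
terminating parameter `q ^ (-2 m)`, and one remaining parameter equal to `q`. -/
theorem sum_pairFactor_singleFactor {K : Type*} [Field K] (q U V : K)
    (hq : ∀ j : ℕ, 1 - q ^ (j + 1) ≠ 0) (m : ℕ)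
    (hD : ∀ j < m, 1 - U * q ^ (2 * j + 2) + V * q ^ (4 * j + 4) ≠ 0) :
    ∑ k ∈ Finset.range (m + 1),
        (1 - q ^ (4 * k + 1)) * pairFactor q U V k * singleFactor q (q ^ (2 * m + 1)) k =
      (1 - q ^ (2 * m + 1)) * ∏ j ∈ Finset.range m,
        (1 - q ^ (2 * j + 1)) * (1 - V * q ^ (2 * j + 1)) /
          (1 - U * q ^ (2 * j + 2) + V * q ^ (4 * j + 4)) := by
  induction m with
  | zero => simp [pairFactor, singleFactor]
  | succ m ih =>
    have ht := sum_pairFactor_singleFactor_telescope q (q ^ (2 * m + 1)) U V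
      (fun j => hq (2 * j + 1)) (fun j => by
        have := hq (2 * m + 1 + 2 * j + 1)
        rwa [← pow_add]) (m + 1) hD
    -- Termination: this kills both the certificate and the extra last term of the sum for m.
    have h0 : singleFactor q (q ^ (2 * m + 1)) (m + 1) = 0 := by
      rw [singleFactor, Finset.prod_range_succ]; simp
    rw [h0] at ht
    rw [Finset.sum_range_succ (fun k => (1 - q ^ (4 * k + 1)) *
      pairFactor q U V k * singleFactor q (q ^ (2 * m + 1)) k), h0,
      ih (fun j hj => hD j (by omega))] at ht
    have hDm := hD m (by omega)
    rw [Finset.prod_range_succ]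
    have p1 : q ^ (2 * m + 1) * q ^ 2 = q ^ (2 * (m + 1) + 1) := by ring
    have p2 : q ^ (2 * m + 1) * q = q ^ (2 * m + 2) := by ring
    have p3 : (q ^ (2 * m + 2)) ^ 2 = q ^ (4 * m + 4) := by ring
    rw [p1, p2, p3] at ht
    refine mul_left_cancel₀ hDm ?_
    field_simp
    linear_combination ht

/-- The choice U = 2 - t, V = 1 - t + t² makes U and V the sum and product of 1+ωt and 1+ω²t, while
w = 1+t. Multiplying the three linear factors yields (1-y)^3 + t^3 above and (1-z)^3 - (tz)^3 below.
-/
theorem sum_perturbed_terms {K : Type*} [Field K] (q t : K)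
    (hq : ∀ j : ℕ, 1 - q ^ (j + 1) ≠ 0) (m : ℕ) (ht : q ^ (2 * m + 1) = 1 + t)
    (hD : ∀ j < m, 1 - (2 - t) * q ^ (2 * j + 2) + (1 - t + t ^ 2) * q ^ (4 * j + 4) ≠ 0) :
    q ^ (2 * m * (m + 1)) * ∑ k ∈ Finset.range (m + 1), (1 - q ^ (4 * k + 1)) *
      ∏ j ∈ Finset.range k, (1 - q ^ (2 * j + 1)) * ((1 - q ^ (2 * j + 1)) ^ 3 + t ^ 3) /
        ((1 - q ^ (2 * j + 2)) * ((1 - q ^ (2 * j + 2)) ^ 3 - (t * q ^ (2 * j + 2)) ^ 3)) =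
      -t * ∏ j ∈ Finset.range m,
        (1 - q ^ (2 * j + 2) + t) * (1 - q ^ (2 * j + 2) + t ^ 3) /
          (1 - (2 - t) * q ^ (2 * j + 2) + (1 - t + t ^ 2) * q ^ (4 * j + 4)) := by
  have h := sum_pairFactor_singleFactor q (2 - t) (1 - t + t ^ 2) hq m hD
  have e1 : ∀ k, pairFactor q (2 - t) (1 - t + t ^ 2) k * singleFactor q (q ^ (2 * m + 1)) k =
      ∏ j ∈ Finset.range k, (1 - q ^ (2 * j + 1)) * ((1 - q ^ (2 * j + 1)) ^ 3 + t ^ 3) /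
        ((1 - q ^ (2 * j + 2)) * ((1 - q ^ (2 * j + 2)) ^ 3 - (t * q ^ (2 * j + 2)) ^ 3)) := by
    intro k
    rw [pairFactor, singleFactor, ← Finset.prod_mul_distrib]
    refine Finset.prod_congr rfl fun j _ => ?_
    rw [ht, div_mul_div_comm]
    congr 1 <;> ring
  simp only [mul_assoc, e1] at h
  rw [h]
  -- Reversing the product pairs z = q^(2j+2) with y = q^(2(m-1-j)+1), so that zy = 1+t. The power
  -- of q in front supplies one z² per factor, and V(1+t) = 1+t³ produces the cube.
  have e2 : ∏ j ∈ Finset.range m, (1 - q ^ (2 * j + 1)) * (1 - (1 - t + t ^ 2) * q ^ (2 * j + 1)) =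
      ∏ j ∈ Finset.range m, (1 - q ^ (2 * (m - 1 - j) + 1)) *
        (1 - (1 - t + t ^ 2) * q ^ (2 * (m - 1 - j) + 1)) :=
    (Finset.prod_range_reflect (fun j => (1 - q ^ (2 * j + 1)) *
      (1 - (1 - t + t ^ 2) * q ^ (2 * j + 1))) m).symm
  have e3 : q ^ (2 * m * (m + 1)) = ∏ j ∈ Finset.range m, q ^ (4 * j + 4) := by
    rw [Finset.prod_pow_eq_pow_sum]
    congr 1
    clear * -
    induction m with
    | zero => rfl
    | succ m ih => rw [Finset.sum_range_succ, ← ih]; ring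
  rw [Finset.prod_div_distrib, e2, e3, Finset.prod_div_distrib, ht]
  rw [show (1 : K) - (1 + t) = -t by ring, mul_left_comm, mul_div_assoc', ← Finset.prod_mul_distrib]
  congr 2
  refine Finset.prod_congr rfl fun j hj => ?_
  have hj' := Finset.mem_range.mp hj
  obtain ⟨i, rfl⟩ : ∃ i, m = j + 1 + i := ⟨m - 1 - j, by omega⟩
  rw [show j + 1 + i - 1 - j = i by omega]
  have h1 : q ^ (2 * j + 2) * q ^ (2 * i + 1) = 1 + t := by rw [← ht]; ring
  have h2 : q ^ (4 * j + 4) = (q ^ (2 * j + 2)) ^ 2 := by ring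
  rw [h2]
  generalize q ^ (2 * j + 2) = z at *
  generalize q ^ (2 * i + 1) = y at *
  have h3 : z ^ 2 * ((1 - y) * (1 - (1 - t + t ^ 2) * y)) =
    (z - z * y) * (z - (1 - t + t ^ 2) * (z * y)) := by ring
  rw [h3, h1]; ring

/-! ### Reflection symmetries at a root of unity of odd order. -/

section RootOfUnity

variable {k : Type*} [Field k] {ζ : k} {M : ℕ}

theorem one_sub_pow_ne_zero_of_not_dvd {n : ℕ} (hζ : IsPrimitiveRoot ζ n) {j : ℕ} (hj : ¬ n ∣ j) :
    1 - ζ ^ j ≠ 0 := fun h => hj (hζ.dvd_of_pow_eq_one j (sub_eq_zero.mp h).symm)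

theorem one_sub_pow_ne_zero_of_lt {n : ℕ} (hζ : IsPrimitiveRoot ζ n) {j : ℕ} (h0 : 0 < j)
    (hj : j < n) : 1 - ζ ^ j ≠ 0 :=
  one_sub_pow_ne_zero_of_not_dvd hζ fun h => absurd (Nat.le_of_dvd h0 h) (by omega)

/-- Since ζ^(2M+1) = 1, the reflection i ↦ M - i exchanges numerator and denominator factors up to a
power of ζ. The form is homogeneous because c 0 is not normalised. -/
theorem reflect_mul (hζ : IsPrimitiveRoot ζ (2 * M + 1)) (c : ℕ → k)
    (hc : ∀ j < M, c (j + 1) * (1 - ζ ^ (2 * j + 2)) = c j * (1 - ζ ^ (2 * j + 1))) :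
    ∀ i v, i + v = M → c i * c 0 = ζ ^ v * c M * c v := by
  intro i v
  induction v generalizing i with
  | zero => rintro rfl; simp
  | succ v ih =>
    intro h
    have h1 := ih (i + 1) (by omega)
    have h2 := hc i (by omega)
    have h3 := hc v (by omega)
    have hX : 1 - ζ ^ (2 * i + 1) ≠ 0 := one_sub_pow_ne_zero_of_lt hζ (by omega) (by omega)
    have hXY : ζ ^ (2 * i + 1) * ζ ^ (2 * v + 1) * ζ = 1 := by
      rw [← pow_add, ← pow_succ, ← hζ.pow_eq_one]; congr 1; omega
    rw [show ζ ^ (2 * i + 2) = ζ ^ (2 * i + 1) * ζ by ring] at h2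
    rw [show ζ ^ (2 * v + 2) = ζ ^ (2 * v + 1) * ζ by ring] at h3
    refine mul_right_cancel₀ hX ?_
    rw [pow_succ ζ v]
    generalize ζ ^ (2 * i + 1) = X at *
    generalize ζ ^ (2 * v + 1) = Y at *
    linear_combination (-c 0) * h2 + (1 - X * ζ) * h1 + (ζ ^ v * ζ * c M * X) * h3 +
      (-ζ ^ v * c M * c v + ζ ^ v * ζ * c M * c (v + 1)) * hXY

theorem reflect_pow_four (hζ : IsPrimitiveRoot ζ (2 * M + 1)) (c : ℕ → k)
    (hc : ∀ j < M, c (j + 1) * (1 - ζ ^ (2 * j + 2)) = c j * (1 - ζ ^ (2 * j + 1)))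
    {i v : ℕ} (h : i + v = M) : c i ^ 4 = ζ ^ (4 * v + 1) * c v ^ 4 := by
  by_cases h0 : c 0 = 0
  · have hz : ∀ j ≤ M, c j = 0 := by
      intro j
      induction j with
      | zero => exact fun _ => h0
      | succ j ih =>
        intro hj
        have := hc j (by omega)
        rw [ih (by omega), zero_mul] at this
        exact (mul_eq_zero.mp this).resolve_right
          (one_sub_pow_ne_zero_of_lt hζ (by omega) (by omega))
    rw [hz i (by omega), hz v (by omega)]; simp
  · have h1 := reflect_mul hζ c hc i v h
    have h2 := reflect_mul hζ c hc 0 M (by omega)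
    -- The case i = 0, v = M determines (c M / c 0)^2 up to this power, hence c M ^ 4 = ζ c 0 ^ 4.
    have h3 : ζ ^ M * ζ ^ M * ζ = 1 := by
      rw [← pow_add, ← pow_succ, ← hζ.pow_eq_one]; congr 1; omega
    have h4 : c M ^ 4 = ζ * c 0 ^ 4 := by
      have : c 0 ^ 4 = (ζ ^ M) ^ 2 * c M ^ 4 := by
        rw [show c 0 ^ 4 = (c 0 * c 0) ^ 2 by ring, h2]; ring
      rw [this]; linear_combination (-c M ^ 4) * h3
    refine mul_right_cancel₀ (pow_ne_zero 4 h0) ?_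
    rw [← mul_pow, h1, mul_pow, mul_pow, h4]; ring

theorem reflect_antisymm (hζ : IsPrimitiveRoot ζ (2 * M + 1)) (c : ℕ → k)
    (hc : ∀ j < M, c (j + 1) * (1 - ζ ^ (2 * j + 2)) = c j * (1 - ζ ^ (2 * j + 1)))
    {i v : ℕ} (h : i + v = M) :
    (1 - ζ ^ (4 * i + 1)) * c i ^ 4 = -((1 - ζ ^ (4 * v + 1)) * c v ^ 4) := by
  have h1 : ζ ^ (4 * i + 1) * ζ ^ (4 * v + 1) = 1 := by
    rw [← pow_add, show 4 * i + 1 + (4 * v + 1) = (2 * M + 1) * 2 by omega, pow_mul,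
      hζ.pow_eq_one, one_pow]
  rw [reflect_pow_four hζ c hc h]
  linear_combination (-c v ^ 4) * h1

theorem sum_eq_zero_of_antisymm [CharZero k] (f : ℕ → k) (m : ℕ)
    (hf : ∀ i j, i + j + 1 = m → f i = -f j) : ∑ i ∈ Finset.range m, f i = 0 := by
  have h : ∑ i ∈ Finset.range m, f i = -∑ i ∈ Finset.range m, f i := by
    rw [← Finset.sum_neg_distrib, ← Finset.sum_range_reflect]
    refine Finset.sum_congr rfl fun i hi => hf _ _ ?_
    have := Finset.mem_range.mp hi
    omega
  exact self_eq_neg.mp h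

/-- This is the t³ coefficient of the perturbation. Reflection sends σ to -r, so the inner sums are
symmetric under i ↦ M - i while the outer weights are antisymmetric. -/
theorem sum_mul_log_derivative_eq_zero [CharZero k] (hζ : IsPrimitiveRoot ζ (2 * M + 1))
    (c σ r : ℕ → k)
    (hc : ∀ j < M, c (j + 1) * (1 - ζ ^ (2 * j + 2)) = c j * (1 - ζ ^ (2 * j + 1)))
    (hσ : ∀ j < M, σ j * (1 - ζ ^ (2 * j + 1)) = 1)
    (hr : ∀ j < M, r j * (1 - ζ ^ (2 * j + 2)) = ζ ^ (2 * j + 2)) :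
    ∑ i ∈ Finset.range (M + 1), (1 - ζ ^ (4 * i + 1)) * c i ^ 4 *
      ∑ j ∈ Finset.range i, (σ j ^ 3 + r j ^ 3) = 0 := by
  have hσr : ∀ i j, i + j + 1 = M → σ i = -r j := by
    intro i j h
    have h1 := hσ i (by omega)
    have h2 := hr j (by omega)
    have h3 : ζ ^ (2 * i + 1) * ζ ^ (2 * j + 2) = 1 := by
      rw [← pow_add, ← hζ.pow_eq_one]; congr 1; omega
    have h4 : 1 - ζ ^ (2 * i + 1) ≠ 0 := one_sub_pow_ne_zero_of_lt hζ (by omega) (by omega)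
    have h5 : 1 - ζ ^ (2 * j + 2) ≠ 0 := one_sub_pow_ne_zero_of_lt hζ (by omega) (by omega)
    refine mul_right_cancel₀ h4 (mul_right_cancel₀ h5 ?_)
    linear_combination (1 - ζ ^ (2 * j + 2)) * h1 + (1 - ζ ^ (2 * i + 1)) * h2 - h3
  have hl : ∀ v i, i + v = M → ∑ j ∈ Finset.range i, (σ j ^ 3 + r j ^ 3) =
      ∑ j ∈ Finset.range v, (σ j ^ 3 + r j ^ 3) := by
    intro v
    induction v with
    | zero =>
      rintro i rfl
      rw [Finset.sum_range_zero]
      rw [Finset.sum_add_distrib, ← Finset.sum_range_reflect, ← Finset.sum_add_distrib]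
      refine Finset.sum_eq_zero fun j hj => ?_
      have := Finset.mem_range.mp hj
      rw [hσr (i - 1 - j) j (by omega)]; ring
    | succ v ih =>
      intro i h
      have h1 := ih (i + 1) (by omega)
      rw [Finset.sum_range_succ] at h1
      rw [Finset.sum_range_succ, ← h1, hσr i v (by omega), hσr v i (by omega)]
      ring
  refine sum_eq_zero_of_antisymm _ _ fun i j h => ?_
  rw [reflect_antisymm hζ c hc (show i + j = M by omega), hl j i (by omega)]
  ring

theorem tail_antisymm (hζ : IsPrimitiveRoot ζ (2 * M + 1)) (d : ℕ → k)
    (hd : ∀ j, j + 1 < M → d (j + 1) * (1 - ζ ^ (2 * j + 3)) = d j * (1 - ζ ^ (2 * j + 2)))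
    {i v : ℕ} (h : i + v + 1 = M) :
    (1 - ζ ^ (4 * i + 3)) * d i ^ 4 = -((1 - ζ ^ (4 * v + 3)) * d v ^ 4) := by
  obtain ⟨N, rfl⟩ : ∃ N, M = N + 1 := ⟨M - 1, by omega⟩
  have key : ∀ v i, i + v = N → d i * d 0 = ζ ^ v * d N * d v := by
    intro v
    induction v with
    | zero => rintro i rfl; simp
    | succ v ih =>
      intro i h
      have h1 := ih (i + 1) (by omega)
      have h2 := hd i (by omega)
      have h3 := hd v (by omega)
      have hX : 1 - ζ ^ (2 * i + 2) ≠ 0 := one_sub_pow_ne_zero_of_lt hζ (by omega) (by omega)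
      have hXY : ζ ^ (2 * i + 2) * ζ ^ (2 * v + 2) * ζ = 1 := by
        rw [← pow_add, ← pow_succ, ← hζ.pow_eq_one]; congr 1; omega
      rw [show ζ ^ (2 * i + 3) = ζ ^ (2 * i + 2) * ζ by ring] at h2
      rw [show ζ ^ (2 * v + 3) = ζ ^ (2 * v + 2) * ζ by ring] at h3
      refine mul_right_cancel₀ hX ?_
      rw [pow_succ ζ v]
      generalize ζ ^ (2 * i + 2) = X at *
      generalize ζ ^ (2 * v + 2) = Y at *
      linear_combination (-d 0) * h2 + (1 - X * ζ) * h1 + (ζ ^ v * ζ * d N * X) * h3 +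
        (-ζ ^ v * d N * d v + ζ ^ v * ζ * d N * d (v + 1)) * hXY
  have h4 : d i ^ 4 = ζ ^ (4 * v + 3) * d v ^ 4 := by
    by_cases h0 : d 0 = 0
    · have hz : ∀ j ≤ N, d j = 0 := by
        intro j
        induction j with
        | zero => exact fun _ => h0
        | succ j ih =>
          intro hj
          have := hd j (by omega)
          rw [ih (by omega), zero_mul] at this
          exact (mul_eq_zero.mp this).resolve_right
            (one_sub_pow_ne_zero_of_lt hζ (by omega) (by omega))
      rw [hz i (by omega), hz v (by omega)]; simp
    · have h1 := key v i (by omega)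
      have h2 := key N 0 (by omega)
      have h3 : ζ ^ N * ζ ^ N * ζ ^ 3 = 1 := by
        rw [← pow_add, ← pow_add, ← hζ.pow_eq_one]; congr 1; omega
      have h4 : d N ^ 4 = ζ ^ 3 * d 0 ^ 4 := by
        have : d 0 ^ 4 = (ζ ^ N) ^ 2 * d N ^ 4 := by
          rw [show d 0 ^ 4 = (d 0 * d 0) ^ 2 by ring, h2]; ring
        rw [this]; linear_combination (-d N ^ 4) * h3
      refine mul_right_cancel₀ (pow_ne_zero 4 h0) ?_
      rw [← mul_pow, h1, mul_pow, mul_pow, h4]; ring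
  have h1 : ζ ^ (4 * i + 3) * ζ ^ (4 * v + 3) = 1 := by
    rw [← pow_add, show 4 * i + 3 + (4 * v + 3) = (2 * (N + 1) + 1) * 2 by omega, pow_mul,
      hζ.pow_eq_one, one_pow]
  rw [h4]
  linear_combination (-d v ^ 4) * h1

/-- The weights in d are antisymmetric under u ↦ M-1-u. The partial sums are symmetric under the
same reflection, because the full sum of an antisymmetric sequence is zero. -/
theorem sum_tail_mul_partial_sum_eq_zero [CharZero k] (hζ : IsPrimitiveRoot ζ (2 * M + 1))
    (c d : ℕ → k)
    (hc : ∀ j < M, c (j + 1) * (1 - ζ ^ (2 * j + 2)) = c j * (1 - ζ ^ (2 * j + 1)))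
    (hd : ∀ j, j + 1 < M → d (j + 1) * (1 - ζ ^ (2 * j + 3)) = d j * (1 - ζ ^ (2 * j + 2))) :
    ∑ u ∈ Finset.range M, (1 - ζ ^ (4 * u + 3)) * d u ^ 4 *
      ∑ i ∈ Finset.range (M - u), (1 - ζ ^ (4 * i + 1)) * c i ^ 4 = 0 := by
  have h0 : ∑ i ∈ Finset.range (M + 1), (1 - ζ ^ (4 * i + 1)) * c i ^ 4 = 0 :=
    sum_eq_zero_of_antisymm _ _ fun i j h => reflect_antisymm hζ c hc (by omega)
  have hA : ∀ v i, i + v = M + 1 → ∑ i ∈ Finset.range i, (1 - ζ ^ (4 * i + 1)) * c i ^ 4 =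
      ∑ i ∈ Finset.range v, (1 - ζ ^ (4 * i + 1)) * c i ^ 4 := by
    intro v
    induction v with
    | zero => rintro i rfl; rw [h0]; simp
    | succ v ih =>
      intro i h
      have h1 := ih (i + 1) (by omega)
      rw [Finset.sum_range_succ] at h1
      rw [Finset.sum_range_succ, ← h1, reflect_antisymm hζ c hc (show i + v = M by omega)]
      ring
  refine sum_eq_zero_of_antisymm _ _ fun i j h => ?_
  rw [tail_antisymm hζ d hd h, hA (M - j) (M - i) (by omega)]
  ring

theorem block_tail_eq_zero (hζ : IsPrimitiveRoot ζ (2 * M + 1)) (L : ℕ) (b : ℕ → k)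
    (hb : ∀ j, j + 1 < (2 * M + 1) * L →
      b (j + 1) * (1 - ζ ^ (2 * j + 2)) = b j * (1 - ζ ^ (2 * j + 1)))
    {u v : ℕ} (hu : u < L) (hv : M < v) (hv' : v < 2 * M + 1) : b ((2 * M + 1) * u + v) = 0 := by
  have hle : (2 * M + 1) * (u + 1) ≤ (2 * M + 1) * L := Nat.mul_le_mul_left _ hu
  have hpow : ∀ j, ζ ^ (2 * ((2 * M + 1) * u) + j) = ζ ^ j := by
    intro j
    rw [pow_add, mul_left_comm, pow_mul, hζ.pow_eq_one, one_pow, one_mul]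
  induction v, hv using Nat.le_induction with
  | base =>
    -- At the middle of a block the factor 1 - ζ^(2j+1) is zero, which annihilates the next term;
    -- the zero then propagates to the end of the block.
    have h1 := hb ((2 * M + 1) * u + M) (by rw [mul_add] at hle; omega)
    rw [show 2 * ((2 * M + 1) * u + M) + 2 = 2 * ((2 * M + 1) * u) + (2 * M + 2) by ring,
      show 2 * ((2 * M + 1) * u + M) + 1 = 2 * ((2 * M + 1) * u) + (2 * M + 1) by ring, hpow, hpow,
      hζ.pow_eq_one, sub_self, mul_zero] at h1
    refine (mul_eq_zero.mp h1).resolve_right (one_sub_pow_ne_zero_of_not_dvd hζ fun h => ?_)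
    have := (Nat.dvd_add_right (dvd_refl (2 * M + 1))).mp (show 2 * M + 1 ∣ 2 * M + 1 + 1 from h)
    have := Nat.le_of_dvd one_pos this
    omega
  | succ v hv ih =>
    have h1 := hb ((2 * M + 1) * u + v) (by rw [mul_add] at hle; omega)
    rw [ih (by omega), zero_mul,
      show 2 * ((2 * M + 1) * u + v) + 2 = 2 * ((2 * M + 1) * u) + (2 * v + 2) by ring, hpow] at h1
    refine (mul_eq_zero.mp h1).resolve_right (one_sub_pow_ne_zero_of_not_dvd hζ fun h => ?_)
    obtain ⟨e, he⟩ := h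
    rcases e with _ | _ | e
    · omega
    · omega
    · nlinarith

theorem block_sum_eq_zero [CharZero k] (hζ : IsPrimitiveRoot ζ (2 * M + 1)) (L : ℕ) (b : ℕ → k)
    (hb : ∀ j, j + 1 < (2 * M + 1) * L →
      b (j + 1) * (1 - ζ ^ (2 * j + 2)) = b j * (1 - ζ ^ (2 * j + 1)))
    {u : ℕ} (hu : u < L) :
    ∑ v ∈ Finset.range (2 * M + 1), (1 - ζ ^ (4 * ((2 * M + 1) * u + v) + 1)) *
      b ((2 * M + 1) * u + v) ^ 4 = 0 := by
  have hle : (2 * M + 1) * (u + 1) ≤ (2 * M + 1) * L := Nat.mul_le_mul_left _ hu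
  have hpow : ∀ e j, ζ ^ (e * ((2 * M + 1) * u) + j) = ζ ^ j := by
    intro e j
    rw [pow_add, mul_left_comm, pow_mul, hζ.pow_eq_one, one_pow, one_mul]
  rw [show 2 * M + 1 = (M + 1) + M by ring, Finset.sum_range_add, ← show 2 * M + 1 = (M + 1) + M by ring]
  rw [Finset.sum_eq_zero (s := Finset.range M), add_zero]
  · refine sum_eq_zero_of_antisymm _ _ fun i j h => ?_
    have := reflect_antisymm hζ (fun v => b ((2 * M + 1) * u + v)) (fun j hj => by
      have h1 := hb ((2 * M + 1) * u + j) (by rw [mul_add] at hle; omega)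
      rw [mul_add 2 _ j, add_assoc _ (2 * j), add_assoc _ (2 * j), hpow, hpow] at h1
      exact h1) (show i + j = M by omega)
    rw [mul_add 4 _ j, mul_add 4 _ i, add_assoc _ (4 * j), add_assoc _ (4 * i), hpow, hpow]
    exact this
  · intro i hi
    have := Finset.mem_range.mp hi
    rw [block_tail_eq_zero hζ L b hb hu (by omega) (by omega)]
    ring

theorem sum_range_mul_eq {R : Type*} [AddCommMonoid R] (d L : ℕ) (f : ℕ → R) :
    ∑ i ∈ Finset.range (d * L), f i =
      ∑ u ∈ Finset.range L, ∑ v ∈ Finset.range d, f (d * u + v) := by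
  induction L with
  | zero => simp
  | succ L ih => rw [mul_add, mul_one, Finset.sum_range_add, ih, Finset.sum_range_succ]

/-- The double sum vanishes at every root of unity of odd order dividing its length. -/
theorem double_sum_root_of_unity_eq_zero [CharZero k] (hζ : IsPrimitiveRoot ζ (2 * M + 1)) (L : ℕ)
    (b : ℕ → k)
    (hb : ∀ j, j + 1 < (2 * M + 1) * L →
      b (j + 1) * (1 - ζ ^ (2 * j + 2)) = b j * (1 - ζ ^ (2 * j + 1))) :
    ∑ i ∈ Finset.range ((2 * M + 1) * L), ∑ j ∈ Finset.range ((2 * M + 1) * L - i),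
      ((1 - ζ ^ (4 * i + 1)) * b i ^ 4) * ((1 - ζ ^ (4 * j + 1)) * b j ^ 4) = 0 := by
  set a : ℕ → k := fun i => (1 - ζ ^ (4 * i + 1)) * b i ^ 4 with ha
  have hz : ∀ u < L, ∀ v, M < v → v < 2 * M + 1 → a ((2 * M + 1) * u + v) = 0 := by
    intro u hu v hv hv'
    simp only [ha]
    rw [block_tail_eq_zero hζ L b hb hu hv hv']; ring
  have hs : ∀ u < L, ∑ v ∈ Finset.range (2 * M + 1), a ((2 * M + 1) * u + v) = 0 :=
    fun u hu => block_sum_eq_zero hζ L b hb hu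
  rw [sum_range_mul_eq]
  refine Finset.sum_eq_zero fun u hu => ?_
  have hu := Finset.mem_range.mp hu
  have : ∀ v ∈ Finset.range (2 * M + 1),
      ∑ j ∈ Finset.range ((2 * M + 1) * L - ((2 * M + 1) * u + v)),
        a ((2 * M + 1) * u + v) * a j = 0 := by
    intro v hv
    have hv := Finset.mem_range.mp hv
    by_cases hvM : M < v
    · simp [hz u hu v hvM hv]
    rw [← Finset.mul_sum]
    suffices h : ∑ j ∈ Finset.range ((2 * M + 1) * L - ((2 * M + 1) * u + v)), a j = 0 by
      rw [h, mul_zero]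
    obtain ⟨w, rfl⟩ : ∃ w, L = u + w + 1 := ⟨L - u - 1, by omega⟩
    -- As v ≤ M, the inner range consists of w full blocks and at least M+1 terms of the next one;
    -- the missing terms of that block are zero.
    have e : (2 * M + 1) * (u + w + 1) - ((2 * M + 1) * u + v) =
        (2 * M + 1) * w + (2 * M + 1 - v) := by
      have : (2 * M + 1) * (u + w + 1) = (2 * M + 1) * u + (2 * M + 1) * w + (2 * M + 1) := by ring
      omega
    rw [e, Finset.sum_range_add, sum_range_mul_eq,
      Finset.sum_eq_zero (s := Finset.range w) fun x hx => hs x (by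
        have := Finset.mem_range.mp hx; omega), zero_add, ← hs w (by omega)]
    refine Finset.sum_subset (Finset.range_subset_range.mpr (by omega)) fun x hx hx' => ?_
    simp only [Finset.mem_range] at hx hx'
    exact hz w (by omega) x (by omega) hx
  exact Finset.sum_eq_zero this

end RootOfUnity

/-! ### Congruences modulo powers of π near a root of unity. -/

/-- A ring homomorphism `φ` to a field whose kernel is generated by `π`, which detects units, and
which sends `q`, not itself a root of unity, to a primitive root of unity of order `2 * M + 1`. -/
structure IsRootDeformation {O k : Type*} [CommRing O] [Field k] (φ : O →+* k) (π q : O) (M : ℕ) :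
    Prop where
  isUnit : ∀ x, φ x ≠ 0 → IsUnit x
  dvd : ∀ x, φ x = 0 → π ∣ x
  primitive : IsPrimitiveRoot (φ q) (2 * M + 1)
  pow_ne_one : ∀ j : ℕ, q ^ (j + 1) ≠ 1

section Deformation

open Finset

variable {O k : Type*} [CommRing O] [Field k] {φ : O →+* k} {π q : O} {M : ℕ}

namespace IsRootDeformation

theorem isUnit_one_sub (H : IsRootDeformation φ π q M) {j : ℕ} (h0 : 0 < j) (hj : j < 2 * M + 1) :
    IsUnit (1 - q ^ j) :=
  H.isUnit _ (by simpa using one_sub_pow_ne_zero_of_lt H.primitive h0 hj)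

theorem isUnit_base (H : IsRootDeformation φ π q M) : IsUnit q :=
  H.isUnit _ (H.primitive.ne_zero (by omega))

theorem map_pow_order (H : IsRootDeformation φ π q M) : φ (q ^ (2 * M + 1) - 1) = 0 := by
  rw [map_sub, map_pow, H.primitive.pow_eq_one, map_one, sub_self]

theorem dvd_pow_order_sub_one (H : IsRootDeformation φ π q M) : π ∣ q ^ (2 * M + 1) - 1 :=
  H.dvd _ H.map_pow_order

theorem map_recurrence (φ : O →+* k) {b : ℕ → O}
    (hb : ∀ j < 2 * M, b (j + 1) * (1 - q ^ (2 * j + 2)) = b j * (1 - q ^ (2 * j + 1))) :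
    ∀ j < M, φ (b (j + 1)) * (1 - φ q ^ (2 * j + 2)) = φ (b j) * (1 - φ q ^ (2 * j + 1)) := by
  intro j hj
  simpa using congrArg φ (hb j (by omega))

/-- The numerator factor at j = M is 1 - q^(2M+1), while all later denominator factors are units; so
one factor of t persists in every term past M. -/
theorem exists_tail [IsDomain O] (H : IsRootDeformation φ π q M) {b : ℕ → O}
    (hb : ∀ j < 2 * M, b (j + 1) * (1 - q ^ (2 * j + 2)) = b j * (1 - q ^ (2 * j + 1))) :
    ∃ d : ℕ → O, (∀ u < M, b (M + 1 + u) = (q ^ (2 * M + 1) - 1) * d u) ∧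
      ∀ j, j + 1 < M →
        φ (d (j + 1)) * (1 - φ q ^ (2 * j + 3)) = φ (d j) * (1 - φ q ^ (2 * j + 2)) := by
  have hζ := H.primitive.pow_eq_one
  have ht : q ^ (2 * M + 1) - 1 ≠ 0 := sub_ne_zero.mpr (H.pow_ne_one _)
  have hu : ∀ u < M, IsUnit (1 - q ^ (2 * (M + u) + 2)) := by
    intro u hu
    refine H.isUnit _ ?_
    have e : φ (1 - q ^ (2 * (M + u) + 2)) = 1 - φ q ^ (2 * u + 1) := by
      rw [map_sub, map_one, map_pow, show 2 * (M + u) + 2 = (2 * M + 1) + (2 * u + 1) by ring,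
        pow_add, hζ, one_mul]
    rw [e]
    exact one_sub_pow_ne_zero_of_lt H.primitive (by omega) (by omega)
  have hdvd : ∀ u < M, (q ^ (2 * M + 1) - 1) ∣ b (M + 1 + u) := by
    intro u
    induction u with
    | zero =>
      intro h
      have h1 := hb M (by omega)
      refine ((hu 0 h).dvd_mul_right).mp ⟨-b M, ?_⟩
      rw [add_zero, add_zero, h1]; ring
    | succ u ih =>
      intro h
      have h1 := hb (M + 1 + u) (by omega)
      refine ((hu (u + 1) h).dvd_mul_right).mp ?_
      rw [show M + (u + 1) = M + 1 + u by ring, show M + 1 + (u + 1) = M + 1 + u + 1 by ring, h1]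
      exact (ih (by omega)).mul_right _
  choose! d hd using hdvd
  refine ⟨d, hd, fun j hj => ?_⟩
  have h1 := hb (M + 1 + j) (by omega)
  rw [add_assoc (M + 1), hd j (by omega), hd (j + 1) hj] at h1
  have h2 : d (j + 1) * (1 - q ^ (2 * (M + 1 + j) + 2)) =
      d j * (1 - q ^ (2 * (M + 1 + j) + 1)) := by
    refine mul_left_cancel₀ ht ?_
    rw [← mul_assoc, ← mul_assoc, h1]
  have h3 := congrArg φ h2
  simp only [map_mul, map_sub, map_one, map_pow] at h3
  rwa [show 2 * (M + 1 + j) + 2 = (2 * M + 1) + (2 * j + 3) by ring,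
    show 2 * (M + 1 + j) + 1 = (2 * M + 1) + (2 * j + 2) by ring, pow_add _ (2 * M + 1), hζ,
    one_mul, pow_add _ (2 * M + 1), hζ, one_mul] at h3

end IsRootDeformation

/-- The triangle i + j ≤ 2M contains the square i, j ≤ M, and outside it exactly one index exceeds
M. -/
theorem sum_triangle_eq {R : Type*} [CommRing R] (a : ℕ → R) (M : ℕ) :
    ∑ i ∈ range (2 * M + 1), ∑ j ∈ range (2 * M + 1 - i), a i * a j =
      (∑ i ∈ range (M + 1), a i) ^ 2 +
        2 * ∑ u ∈ range M, a (M + 1 + u) * ∑ i ∈ range (M - u), a i := by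
  have h1 : ∀ i ∈ range (M + 1), ∑ j ∈ range (2 * M + 1 - i), a i * a j =
      a i * ∑ j ∈ range (M + 1), a j + ∑ u ∈ range (M - i), a i * a (M + 1 + u) := by
    intro i hi
    have := mem_range.mp hi
    rw [show 2 * M + 1 - i = (M + 1) + (M - i) by omega, sum_range_add, mul_sum]
  have h2 : ∀ u ∈ range M, ∑ j ∈ range (2 * M + 1 - (M + 1 + u)), a (M + 1 + u) * a j =
      a (M + 1 + u) * ∑ j ∈ range (M - u), a j := by
    intro u hu
    rw [show 2 * M + 1 - (M + 1 + u) = M - u by omega, mul_sum]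
  have h3 : ∑ i ∈ range (M + 1), ∑ u ∈ range (M - i), a i * a (M + 1 + u) =
      ∑ u ∈ range M, a (M + 1 + u) * ∑ i ∈ range (M - u), a i := by
    rw [sum_comm' (t' := range M) (s' := fun u => range (M - u))]
    · simp_rw [mul_sum, mul_comm]
    · intro i u
      simp only [mem_range]
      omega
  rw [show range (2 * M + 1) = range ((M + 1) + M) by congr 1; ring, sum_range_add,
    sum_congr rfl h1, sum_congr rfl h2, sum_add_distrib, h3, ← sum_mul]
  ring

namespace IsRootDeformation

theorem dvd_sum_triangle_sub_sq [IsDomain O] [CharZero k] (H : IsRootDeformation φ π q M) {b : ℕ → O}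
    (hb : ∀ j < 2 * M, b (j + 1) * (1 - q ^ (2 * j + 2)) = b j * (1 - q ^ (2 * j + 1))) :
    π ^ 5 ∣ ∑ i ∈ range (2 * M + 1), ∑ j ∈ range (2 * M + 1 - i),
        ((1 - q ^ (4 * i + 1)) * b i ^ 4) * ((1 - q ^ (4 * j + 1)) * b j ^ 4) -
      (∑ i ∈ range (M + 1), (1 - q ^ (4 * i + 1)) * b i ^ 4) ^ 2 := by
  obtain ⟨d, hd, hd'⟩ := H.exists_tail hb
  have h0 := sum_tail_mul_partial_sum_eq_zero H.primitive (fun j => φ (b j)) (fun j => φ (d j))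
    (map_recurrence φ hb) hd'
  rw [sum_triangle_eq (fun i => (1 - q ^ (4 * i + 1)) * b i ^ 4), add_sub_cancel_left]
  have h1 : ∑ u ∈ range M, (1 - q ^ (4 * (M + 1 + u) + 1)) * b (M + 1 + u) ^ 4 *
        ∑ i ∈ range (M - u), (1 - q ^ (4 * i + 1)) * b i ^ 4 =
      (q ^ (2 * M + 1) - 1) ^ 4 * ∑ u ∈ range M, (1 - q ^ (4 * (M + 1 + u) + 1)) * d u ^ 4 *
        ∑ i ∈ range (M - u), (1 - q ^ (4 * i + 1)) * b i ^ 4 := by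
    rw [mul_sum]
    refine sum_congr rfl fun u hu => ?_
    rw [hd u (mem_range.mp hu)]; ring
  rw [h1, pow_succ]
  refine Dvd.dvd.mul_left (mul_dvd_mul (pow_dvd_pow_of_dvd H.dvd_pow_order_sub_one 4)
    (H.dvd _ ?_)) _
  rw [← h0, map_sum]
  refine sum_congr rfl fun u _ => ?_
  simp only [map_mul, map_sub, map_one, map_pow, map_sum]
  rw [show 4 * (M + 1 + u) + 1 = (2 * M + 1) * 2 + (4 * u + 3) by ring, pow_add, pow_mul,
    H.primitive.pow_eq_one, one_pow, one_mul]

theorem isUnit_denom (H : IsRootDeformation φ π q M) {j : ℕ} (hj : j < M) :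
    IsUnit (1 - (2 - (q ^ (2 * M + 1) - 1)) * q ^ (2 * j + 2) +
      (1 - (q ^ (2 * M + 1) - 1) + (q ^ (2 * M + 1) - 1) ^ 2) * q ^ (4 * j + 4)) := by
  refine H.isUnit _ ?_
  have h := H.map_pow_order
  generalize q ^ (2 * M + 1) - 1 = t at *
  have e : φ (1 - (2 - t) * q ^ (2 * j + 2) + (1 - t + t ^ 2) * q ^ (4 * j + 4)) =
      (1 - φ q ^ (2 * j + 2)) ^ 2 := by
    simp only [map_add, map_sub, map_mul, map_pow, map_one, h, map_ofNat]
    ring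
  rw [e]
  exact pow_ne_zero 2 (one_sub_pow_ne_zero_of_lt H.primitive (by omega) (by omega))

theorem isUnit_cubic (H : IsRootDeformation φ π q M) {j : ℕ} (hj : j < M) :
    IsUnit ((1 - q ^ (2 * j + 2)) *
      ((1 - q ^ (2 * j + 2)) ^ 3 - ((q ^ (2 * M + 1) - 1) * q ^ (2 * j + 2)) ^ 3)) := by
  refine H.isUnit _ ?_
  have h := H.map_pow_order
  generalize q ^ (2 * M + 1) - 1 = t at *
  have e : φ ((1 - q ^ (2 * j + 2)) * ((1 - q ^ (2 * j + 2)) ^ 3 - (t * q ^ (2 * j + 2)) ^ 3)) =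
      (1 - φ q ^ (2 * j + 2)) ^ 4 := by
    simp only [map_sub, map_mul, map_pow, map_one, h]
    ring
  rw [e]
  exact pow_ne_zero 4 (one_sub_pow_ne_zero_of_lt H.primitive (by omega) (by omega))

/-- The perturbed summation with terms `x k` determined by their recurrence. -/
theorem sum_perturbed_eq [IsDomain O] (H : IsRootDeformation φ π q M) {x f : ℕ → O}
    (hx0 : x 0 = 1)
    (hx : ∀ j < M, x (j + 1) * ((1 - q ^ (2 * j + 2)) *
      ((1 - q ^ (2 * j + 2)) ^ 3 - ((q ^ (2 * M + 1) - 1) * q ^ (2 * j + 2)) ^ 3)) =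
      x j * ((1 - q ^ (2 * j + 1)) * ((1 - q ^ (2 * j + 1)) ^ 3 + (q ^ (2 * M + 1) - 1) ^ 3)))
    (hf : ∀ j < M, f j * (1 - (2 - (q ^ (2 * M + 1) - 1)) * q ^ (2 * j + 2) +
      (1 - (q ^ (2 * M + 1) - 1) + (q ^ (2 * M + 1) - 1) ^ 2) * q ^ (4 * j + 4)) =
      (1 - q ^ (2 * j + 2) + (q ^ (2 * M + 1) - 1)) *
        (1 - q ^ (2 * j + 2) + (q ^ (2 * M + 1) - 1) ^ 3)) :
    q ^ (2 * M * (M + 1)) * ∑ i ∈ range (M + 1), (1 - q ^ (4 * i + 1)) * x i =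
      -(q ^ (2 * M + 1) - 1) * ∏ j ∈ range M, f j := by
  have hD := fun j (hj : j < M) => H.isUnit_denom hj
  have hC := fun j (hj : j < M) => H.isUnit_cubic hj
  have hq1 := H.pow_ne_one
  have hqt : q ^ (2 * M + 1) = 1 + (q ^ (2 * M + 1) - 1) := by ring
  generalize q ^ (2 * M + 1) - 1 = t at *
  set ι := algebraMap O (FractionRing O) with hι
  have hinj : Function.Injective ι := IsFractionRing.injective O (FractionRing O)
  have hι2 : ι 2 = 2 := map_ofNat ι 2
  refine hinj ?_
  have hD' : ∀ j < M, 1 - (2 - ι t) * ι q ^ (2 * j + 2) +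
      (1 - ι t + ι t ^ 2) * ι q ^ (4 * j + 4) ≠ 0 := by
    intro j hj
    simpa [hι2] using ((hD j hj).map ι).ne_zero
  have hC' : ∀ j < M, (1 - ι q ^ (2 * j + 2)) *
      ((1 - ι q ^ (2 * j + 2)) ^ 3 - (ι t * ι q ^ (2 * j + 2)) ^ 3) ≠ 0 := by
    intro j hj
    simpa using ((hC j hj).map ι).ne_zero
  have key := sum_perturbed_terms (ι q) (ι t) (fun j h => hq1 j (hinj (by
    rw [map_pow, map_one]; exact (sub_eq_zero.mp h).symm))) M
    (by rw [← map_pow, hqt, map_add, map_one]) hD'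
  have hxι : ∀ i ≤ M, ι (x i) = ∏ j ∈ range i,
      (1 - ι q ^ (2 * j + 1)) * ((1 - ι q ^ (2 * j + 1)) ^ 3 + ι t ^ 3) /
        ((1 - ι q ^ (2 * j + 2)) * ((1 - ι q ^ (2 * j + 2)) ^ 3 - (ι t * ι q ^ (2 * j + 2)) ^ 3)) := by
    intro i
    induction i with
    | zero => simp [hx0]
    | succ i ih =>
      intro hi
      rw [prod_range_succ, ← ih (by omega), mul_div_assoc', eq_div_iff (hC' i hi)]
      simpa using congrArg ι (hx i hi)
  have hfι : ∀ j < M, ι (f j) = (1 - ι q ^ (2 * j + 2) + ι t) * (1 - ι q ^ (2 * j + 2) + ι t ^ 3) /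
      (1 - (2 - ι t) * ι q ^ (2 * j + 2) + (1 - ι t + ι t ^ 2) * ι q ^ (4 * j + 4)) := by
    intro j hj
    rw [eq_div_iff (hD' j hj)]
    simpa [hι2] using congrArg ι (hf j hj)
  simp only [map_mul, map_neg, map_sum, map_prod, map_pow, map_sub, map_one]
  rw [sum_congr rfl fun i hi => by rw [hxι i (by have := mem_range.mp hi; omega)],
    prod_congr rfl fun j hj => hfι j (mem_range.mp hj)]
  exact key

/-- Each perturbed ratio differs from the true one by (1 + t³σ³)/(1 - t³r³), which is 1 + t³(σ³ +
r³) up to higher order. -/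
theorem dvd_perturbed_sub (H : IsRootDeformation φ π q M) {b x σ r : ℕ → O}
    (hb : ∀ j < 2 * M, b (j + 1) * (1 - q ^ (2 * j + 2)) = b j * (1 - q ^ (2 * j + 1)))
    (hx0 : x 0 = 1)
    (hx : ∀ j < M, x (j + 1) * ((1 - q ^ (2 * j + 2)) *
      ((1 - q ^ (2 * j + 2)) ^ 3 - ((q ^ (2 * M + 1) - 1) * q ^ (2 * j + 2)) ^ 3)) =
      x j * ((1 - q ^ (2 * j + 1)) * ((1 - q ^ (2 * j + 1)) ^ 3 + (q ^ (2 * M + 1) - 1) ^ 3)))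
    (hσ : ∀ j < M, σ j * (1 - q ^ (2 * j + 1)) = 1)
    (hr : ∀ j < M, r j * (1 - q ^ (2 * j + 2)) = q ^ (2 * j + 2)) :
    ∀ i ≤ M, (q ^ (2 * M + 1) - 1) ^ 4 ∣ b i ^ 4 *
      (1 + (q ^ (2 * M + 1) - 1) ^ 3 * ∑ j ∈ range i, (σ j ^ 3 + r j ^ 3)) - b 0 ^ 4 * x i := by
  intro i
  induction i with
  | zero => simp [hx0]
  | succ i ih =>
    intro hi
    obtain ⟨o, ho⟩ := ih (by omega)
    have h1 := hb i (by omega)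
    have h2 := hx i hi
    have h3 := hσ i hi
    have h4 := hr i hi
    rw [← (H.isUnit_cubic hi).dvd_mul_right, sum_range_succ]
    generalize q ^ (2 * M + 1) - 1 = t at *
    generalize ∑ j ∈ range i, (σ j ^ 3 + r j ^ 3) = l at *
    generalize σ i = s at *
    generalize r i = ρ at *
    have h5 : (1 - q ^ (2 * i + 2)) * ((1 - q ^ (2 * i + 2)) ^ 3 - (t * q ^ (2 * i + 2)) ^ 3) =
        (1 - q ^ (2 * i + 2)) ^ 4 * (1 - t ^ 3 * ρ ^ 3) := by
      have : t * q ^ (2 * i + 2) = t * (ρ * (1 - q ^ (2 * i + 2))) := by rw [h4]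
      rw [this]; ring
    have h6 : (1 - q ^ (2 * i + 1)) * ((1 - q ^ (2 * i + 1)) ^ 3 + t ^ 3) =
        (1 - q ^ (2 * i + 1)) ^ 4 * (1 + t ^ 3 * s ^ 3) := by
      have : t ^ 3 = t ^ 3 * (s * (1 - q ^ (2 * i + 1))) ^ 3 := by rw [h3]; ring
      conv_lhs => rw [this]
      ring
    have h7 : b (i + 1) ^ 4 * (1 - q ^ (2 * i + 2)) ^ 4 = b i ^ 4 * (1 - q ^ (2 * i + 1)) ^ 4 := by
      rw [← mul_pow, h1, mul_pow]
    rw [h6] at h2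
    rw [h5] at h2 ⊢
    generalize 1 - q ^ (2 * i + 2) = z at *
    generalize 1 - q ^ (2 * i + 1) = y at *
    refine ⟨y ^ 4 * (1 + t ^ 3 * s ^ 3) * o +
      t ^ 2 * b i ^ 4 * y ^ 4 * (-ρ ^ 3 * (l + s ^ 3 + ρ ^ 3) - s ^ 3 * l), ?_⟩
    linear_combination (-b 0 ^ 4) * h2 + (1 - t ^ 3 * ρ ^ 3) *
      (1 + t ^ 3 * (l + (s ^ 3 + ρ ^ 3))) * h7 + (y ^ 4 * (1 + t ^ 3 * s ^ 3)) * ho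

/-- With z = q^(2j+2), each factor satisfies f ≡ (1+t)(1 - t² z/(1-z)²) modulo t³. The powers of 1+t
= q^(2M+1) are kept exactly, so that they cancel later. -/
theorem dvd_prod_sub (H : IsRootDeformation φ π q M) {f h : ℕ → O}
    (hf : ∀ j < M, f j * (1 - (2 - (q ^ (2 * M + 1) - 1)) * q ^ (2 * j + 2) +
      (1 - (q ^ (2 * M + 1) - 1) + (q ^ (2 * M + 1) - 1) ^ 2) * q ^ (4 * j + 4)) =
      (1 - q ^ (2 * j + 2) + (q ^ (2 * M + 1) - 1)) *
        (1 - q ^ (2 * j + 2) + (q ^ (2 * M + 1) - 1) ^ 3))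
    (hh : ∀ j < M, h j * (1 - q ^ (2 * j + 2)) ^ 2 = q ^ (2 * j + 2)) :
    ∀ i ≤ M, (q ^ (2 * M + 1) - 1) ^ 3 ∣ ∏ j ∈ range i, f j -
      (q ^ (2 * M + 1)) ^ i * (1 - (q ^ (2 * M + 1) - 1) ^ 2 * ∑ j ∈ range i, h j) := by
  intro i
  induction i with
  | zero => simp
  | succ i ih =>
    intro hi
    obtain ⟨o, ho⟩ := ih (by omega)
    have h1 := hf i hi
    have h2 := hh i hi
    have hD := H.isUnit_denom hi
    rw [prod_range_succ, sum_range_succ, pow_succ]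
    have hw : q ^ (2 * M + 1) = 1 + (q ^ (2 * M + 1) - 1) := by ring
    generalize q ^ (2 * M + 1) - 1 = t at *
    rw [hw] at ho ⊢
    rw [show q ^ (4 * i + 4) = (q ^ (2 * i + 2)) ^ 2 by ring] at h1 hD
    generalize q ^ (2 * i + 2) = z at *
    have h3 : t ^ 3 ∣ f i - (1 + t) * (1 - t ^ 2 * h i) := by
      rw [← hD.dvd_mul_right]
      refine ⟨(1 - z + t) - z ^ 2 + (1 + t) * h i * z * (1 - z) +
        (1 + t) * t * h i * z ^ 2 + h i * (1 - z) ^ 2, ?_⟩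
      linear_combination h1 + (t ^ 2) * h2
    obtain ⟨e, he⟩ := h3
    generalize ∑ j ∈ range i, h j = s at *
    generalize ∏ j ∈ range i, f j = p at *
    refine ⟨o * f i + (1 + t) ^ i * (1 - t ^ 2 * s) * e + (1 + t) ^ i * (1 + t) * t * s * h i, ?_⟩
    linear_combination f i * ho + (1 + t) ^ i * (1 - t ^ 2 * s) * he

/-- The single sum modulo the fourth power of `π`. -/
theorem dvd_single_sum [IsDomain O] [CharZero k] (H : IsRootDeformation φ π q M) {b h : ℕ → O}
    (hb : ∀ j < 2 * M, b (j + 1) * (1 - q ^ (2 * j + 2)) = b j * (1 - q ^ (2 * j + 1)))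
    (hh : ∀ j < M, h j * (1 - q ^ (2 * j + 2)) ^ 2 = q ^ (2 * j + 2)) :
    π ^ 4 ∣ q ^ M * ∑ i ∈ range (M + 1), (1 - q ^ (4 * i + 1)) * b i ^ 4 +
      b 0 ^ 4 * (q ^ (2 * M + 1) - 1) *
        (1 - (q ^ (2 * M + 1) - 1) ^ 2 * ∑ j ∈ range M, h j) := by
  have hinv : ∀ y : O, IsUnit y → y * Ring.inverse y = 1 := fun y hy => Ring.mul_inverse_cancel y hy
  set t := q ^ (2 * M + 1) - 1 with ht
  set σ : ℕ → O := fun j => Ring.inverse (1 - q ^ (2 * j + 1)) with hσ_def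
  set r : ℕ → O := fun j => q ^ (2 * j + 2) * Ring.inverse (1 - q ^ (2 * j + 2)) with hr_def
  set f : ℕ → O := fun j => (1 - q ^ (2 * j + 2) + t) * (1 - q ^ (2 * j + 2) + t ^ 3) *
    Ring.inverse (1 - (2 - t) * q ^ (2 * j + 2) + (1 - t + t ^ 2) * q ^ (4 * j + 4)) with hf_def
  set x : ℕ → O := fun i => ∏ j ∈ range i,
    (1 - q ^ (2 * j + 1)) * ((1 - q ^ (2 * j + 1)) ^ 3 + t ^ 3) *
      Ring.inverse ((1 - q ^ (2 * j + 2)) * ((1 - q ^ (2 * j + 2)) ^ 3 -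
        (t * q ^ (2 * j + 2)) ^ 3)) with hx_def
  have hσ : ∀ j < M, σ j * (1 - q ^ (2 * j + 1)) = 1 := fun j hj => by
    rw [mul_comm]; exact hinv _ (H.isUnit_one_sub (by omega) (by omega))
  have hr : ∀ j < M, r j * (1 - q ^ (2 * j + 2)) = q ^ (2 * j + 2) := fun j hj => by
    have := hinv _ (H.isUnit_one_sub (j := 2 * j + 2) (by omega) (by omega))
    simp only [hr_def]
    linear_combination q ^ (2 * j + 2) * this
  have hf : ∀ j < M, f j * (1 - (2 - t) * q ^ (2 * j + 2) +
      (1 - t + t ^ 2) * q ^ (4 * j + 4)) =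
      (1 - q ^ (2 * j + 2) + t) * (1 - q ^ (2 * j + 2) + t ^ 3) := fun j hj => by
    have := hinv _ (H.isUnit_denom hj)
    rw [← ht] at this
    simp only [hf_def]
    rw [mul_assoc, mul_comm (Ring.inverse _), this, mul_one]
  have hx : ∀ j < M, x (j + 1) * ((1 - q ^ (2 * j + 2)) *
      ((1 - q ^ (2 * j + 2)) ^ 3 - (t * q ^ (2 * j + 2)) ^ 3)) =
      x j * ((1 - q ^ (2 * j + 1)) * ((1 - q ^ (2 * j + 1)) ^ 3 + t ^ 3)) := fun j hj => by
    have := hinv _ (H.isUnit_cubic hj)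
    rw [← ht] at this
    simp only [hx_def]
    rw [prod_range_succ, mul_assoc, mul_assoc (_ * _) (Ring.inverse _), mul_comm (Ring.inverse _),
      this, mul_one]
  have hx0 : x 0 = 1 := prod_range_zero _
  have c1 := H.dvd_perturbed_sub hb hx0 hx hσ hr
  have c2 := H.sum_perturbed_eq hx0 hx hf
  obtain ⟨o3, c3⟩ := H.dvd_prod_sub hf hh M le_rfl
  have c4 : π ∣ ∑ i ∈ range (M + 1), (1 - q ^ (4 * i + 1)) * b i ^ 4 *
      ∑ j ∈ range i, (σ j ^ 3 + r j ^ 3) := by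
    refine H.dvd _ ?_
    have := sum_mul_log_derivative_eq_zero H.primitive (fun j => φ (b j)) (fun j => φ (σ j))
      (fun j => φ (r j)) (map_recurrence φ hb) (fun j hj => by simpa using congrArg φ (hσ j hj))
      (fun j hj => by simpa using congrArg φ (hr j hj))
    simpa using this
  rw [← ht] at c1 c2 c3
  have c5 : t ^ 4 ∣ ∑ i ∈ range (M + 1), (1 - q ^ (4 * i + 1)) * (b i ^ 4 *
      (1 + t ^ 3 * ∑ j ∈ range i, (σ j ^ 3 + r j ^ 3)) - b 0 ^ 4 * x i) :=
    dvd_sum fun i hi => (c1 i (by have := mem_range.mp hi; omega)).mul_left _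
  obtain ⟨o4, c4⟩ := c4
  obtain ⟨o5, c5⟩ := c5
  have c6 : ∑ i ∈ range (M + 1), (1 - q ^ (4 * i + 1)) * (b i ^ 4 *
      (1 + t ^ 3 * ∑ j ∈ range i, (σ j ^ 3 + r j ^ 3)) - b 0 ^ 4 * x i) =
      ∑ i ∈ range (M + 1), (1 - q ^ (4 * i + 1)) * b i ^ 4 +
      t ^ 3 * ∑ i ∈ range (M + 1), (1 - q ^ (4 * i + 1)) * b i ^ 4 *
        ∑ j ∈ range i, (σ j ^ 3 + r j ^ 3) -
      b 0 ^ 4 * ∑ i ∈ range (M + 1), (1 - q ^ (4 * i + 1)) * x i := by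
    rw [mul_sum, mul_sum, ← sum_add_distrib, ← sum_sub_distrib]
    exact sum_congr rfl fun i _ => by ring
  rw [c6, c4] at c5
  obtain ⟨e, he⟩ := H.dvd_pow_order_sub_one
  rw [← ht] at he
  -- The unit W = (q^(2M+1))^M also appears in the product expansion; cancelling it leaves q^M.
  have hpow : q ^ (2 * M * (M + 1)) = (q ^ (2 * M + 1)) ^ M * q ^ M := by
    rw [← pow_mul, ← pow_add]; congr 1; ring
  have hunit : IsUnit ((q ^ (2 * M + 1)) ^ M) := (H.isUnit_base.pow _).pow _
  rw [hpow] at c2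
  rw [← hunit.dvd_mul_left]
  generalize ∑ i ∈ range (M + 1), (1 - q ^ (4 * i + 1)) * b i ^ 4 = A at *
  generalize ∑ i ∈ range (M + 1), (1 - q ^ (4 * i + 1)) * x i = X at *
  generalize ∏ j ∈ range M, f j = F at *
  generalize ∑ j ∈ range M, h j = S at *
  generalize (q ^ (2 * M + 1)) ^ M = W at *
  refine ⟨W * q ^ M * (e ^ 4 * o5 - e ^ 3 * o4) - b 0 ^ 4 * e ^ 4 * o3, ?_⟩
  have h3 : t ^ 3 = π ^ 3 * e ^ 3 := by rw [he]; ring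
  have h4 : t ^ 4 = π ^ 4 * e ^ 4 := by rw [he]; ring
  linear_combination W * q ^ M * c5 + b 0 ^ 4 * c2 - b 0 ^ 4 * t * c3 +
    (-W * q ^ M * π * o4) * h3 + (W * q ^ M * o5 - b 0 ^ 4 * o3) * h4

/-- The double sum modulo the fifth power of `π`. -/
theorem dvd_double_sum [IsDomain O] [CharZero k] (H : IsRootDeformation φ π q M) {b h : ℕ → O}
    (hb : ∀ j < 2 * M, b (j + 1) * (1 - q ^ (2 * j + 2)) = b j * (1 - q ^ (2 * j + 1)))
    (hh : ∀ j < M, h j * (1 - q ^ (2 * j + 2)) ^ 2 = q ^ (2 * j + 2)) :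
    π ^ 5 ∣ q ^ (2 * M) * ∑ i ∈ range (2 * M + 1), ∑ j ∈ range (2 * M + 1 - i),
        ((1 - q ^ (4 * i + 1)) * b i ^ 4) * ((1 - q ^ (4 * j + 1)) * b j ^ 4) -
      b 0 ^ 8 * (q ^ (2 * M + 1) - 1) ^ 2 *
        (1 - 2 * (q ^ (2 * M + 1) - 1) ^ 2 * ∑ j ∈ range M, h j) := by
  obtain ⟨x, hx⟩ := H.dvd_sum_triangle_sub_sq hb
  obtain ⟨y, hy⟩ := H.dvd_single_sum hb hh
  obtain ⟨e, he⟩ := H.dvd_pow_order_sub_one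
  generalize q ^ (2 * M + 1) - 1 = t at *
  generalize ∑ i ∈ range (2 * M + 1), ∑ j ∈ range (2 * M + 1 - i),
        ((1 - q ^ (4 * i + 1)) * b i ^ 4) * ((1 - q ^ (4 * j + 1)) * b j ^ 4) = S at *
  generalize ∑ i ∈ range (M + 1), (1 - q ^ (4 * i + 1)) * b i ^ 4 = A at *
  generalize ∑ j ∈ range M, h j = s at *
  have hS : S = A ^ 2 + π ^ 5 * x := by linear_combination hx
  have hA : q ^ M * A = π ^ 4 * y - b 0 ^ 4 * t * (1 - t ^ 2 * s) := by linear_combination hy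
  rw [hS, show q ^ (2 * M) * (A ^ 2 + π ^ 5 * x) = (q ^ M * A) ^ 2 + q ^ (2 * M) * π ^ 5 * x by ring,
    hA, he]
  -- The error π^4 y only meets a second error or the main term, itself divisible by t, so squaring
  -- gains a power of π.
  exact ⟨π ^ 3 * y ^ 2 - 2 * y * b 0 ^ 4 * e * (1 - (π * e) ^ 2 * s) +
    b 0 ^ 8 * π * e ^ 6 * s ^ 2 + q ^ (2 * M) * x, by ring⟩

end IsRootDeformation

end Deformation

/-! ### Integral q-analogues and clearing of denominators. -/

open Polynomial in
/-- The Gaussian binomial coefficient `[m + k choose k]` as a polynomial. -/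
noncomputable def gaussianBinomial : ℕ → ℕ → ℤ[X]
  | 0, _ => 1
  | _ + 1, 0 => 1
  | m + 1, k + 1 => gaussianBinomial (m + 1) k + X ^ (k + 1) * gaussianBinomial m (k + 1)

section Polynomials

open Polynomial Finset

theorem gaussianBinomial_mul (m k : ℕ) :
    gaussianBinomial m k * (∏ j ∈ range m, (1 - (X : ℤ[X]) ^ (j + 1))) *
      ∏ j ∈ range k, (1 - (X : ℤ[X]) ^ (j + 1)) = ∏ j ∈ range (m + k), (1 - (X : ℤ[X]) ^ (j + 1)) := by
  induction m generalizing k with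
  | zero => simp [gaussianBinomial]
  | succ m ihm =>
    induction k with
    | zero => simp [gaussianBinomial]
    | succ k ihk =>
      have h1 := ihm (k + 1)
      rw [show m + (k + 1) = m + 1 + k by ring] at h1
      rw [gaussianBinomial, show m + 1 + (k + 1) = m + 1 + k + 1 by ring,
        prod_range_succ _ (m + 1 + k), prod_range_succ _ k]
      rw [prod_range_succ _ k] at h1
      rw [prod_range_succ _ m] at ihk ⊢
      linear_combination (1 - X ^ (k + 1)) * ihk + (X ^ (k + 1) * (1 - X ^ (m + 1))) * h1

theorem eval_one_gaussianBinomial (m k : ℕ) :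
    (gaussianBinomial m k).eval 1 = ((m + k).choose k : ℤ) := by
  induction m generalizing k with
  | zero => simp [gaussianBinomial]
  | succ m ihm =>
    induction k with
    | zero => simp [gaussianBinomial]
    | succ k ihk =>
      rw [gaussianBinomial, eval_add, eval_mul, ihk, ihm, show m + 1 + (k + 1) = (m + 1 + k) + 1 by ring,
        Nat.choose_succ_succ, show m + (k + 1) = m + 1 + k by ring]
      simp

theorem one_sub_X_pow_ne_zero (j : ℕ) : (1 - X ^ (j + 1) : ℤ[X]) ≠ 0 := by
  intro h
  have := congrArg (eval 0) h
  simp at this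

theorem gaussianBinomial_central_succ (k : ℕ) :
    gaussianBinomial (k + 1) (k + 1) * (1 - X ^ (2 * k + 2)) =
      gaussianBinomial k k * (1 + X ^ (k + 1)) ^ 2 * (1 - X ^ (2 * k + 1)) := by
  have h1 := gaussianBinomial_mul (k + 1) (k + 1)
  have h2 := gaussianBinomial_mul k k
  have h0 : (∏ j ∈ range k, (1 - (X : ℤ[X]) ^ (j + 1))) ≠ 0 :=
    prod_ne_zero_iff.mpr fun j _ => one_sub_X_pow_ne_zero j
  rw [show k + 1 + (k + 1) = k + k + 1 + 1 by ring, prod_range_succ _ (k + k + 1),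
    prod_range_succ _ (k + k), ← h2, prod_range_succ] at h1
  refine mul_right_cancel₀ (pow_ne_zero 2 (mul_ne_zero h0 (one_sub_X_pow_ne_zero k))) ?_
  rw [show k + k + 1 = 2 * k + 1 by ring] at h1
  generalize ∏ j ∈ range k, (1 - (X : ℤ[X]) ^ (j + 1)) = P at *
  linear_combination (1 - X ^ (2 * k + 2)) * h1

/-- A polynomial multiple of the `q`-analogue of `(1/2)_k / k!`, with a common denominator for all
`k < n`. -/
noncomputable def scaledRatio (n k : ℕ) : ℤ[X] :=
  gaussianBinomial k k * ∏ j ∈ Ico (k + 1) n, (1 + X ^ j) ^ 2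

theorem scaledRatio_succ {n k : ℕ} (h : k + 1 < n) :
    scaledRatio n (k + 1) * (1 - X ^ (2 * k + 2)) = scaledRatio n k * (1 - X ^ (2 * k + 1)) := by
  rw [scaledRatio, scaledRatio, prod_eq_prod_Ico_succ_bot h, mul_right_comm,
    gaussianBinomial_central_succ]
  ring

theorem eval_one_scaledRatio (n k : ℕ) :
    (scaledRatio n k).eval 1 = (Nat.centralBinom k : ℤ) * 4 ^ (n - (k + 1)) := by
  rw [scaledRatio, eval_mul, eval_one_gaussianBinomial, eval_prod, Nat.centralBinom, two_mul]
  norm_num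

/-- Write m = p^r u with p ∤ u and divide both 1 - X^(p^s) and 1 - X^m by 1 - X^(p^r). The second
quotient has value u at 1, so clearing it costs no power of p. -/
theorem exists_quotient_of_pow_sub_one {p s m : ℕ} (hp : p.Prime) (h0 : 0 < m) (hm : m < p ^ s) :
    ∃ PU : ℤ[X] × ℤ[X], PU.1 * (1 - X ^ m) = (1 - X ^ (p ^ s)) * PU.2 ∧
      PU.1.eval 1 * m = (p : ℤ) ^ s * PU.2.eval 1 ∧ ¬ (p : ℤ) ∣ PU.2.eval 1 := by
  obtain ⟨r, u, hu, rfl⟩ := Nat.exists_eq_pow_mul_and_not_dvd h0.ne' p hp.ne_one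
  have hr : r ≤ s := by
    by_contra! h
    have h1 : p ^ s ≤ p ^ r := Nat.pow_le_pow_right hp.pos h.le
    have h2 : p ^ r ≤ p ^ r * u := Nat.le_mul_of_pos_right _ (Nat.pos_of_mul_pos_left h0)
    omega
  obtain ⟨w, rfl⟩ := Nat.exists_eq_add_of_le hr
  refine ⟨⟨∑ l ∈ range (p ^ w), (X ^ p ^ r) ^ l, ∑ l ∈ range u, (X ^ p ^ r) ^ l⟩, ?_, ?_, ?_⟩
  · have h1 := geom_sum_mul ((X : ℤ[X]) ^ p ^ r) (p ^ w)
    have h2 := geom_sum_mul ((X : ℤ[X]) ^ p ^ r) u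
    rw [pow_add, pow_mul, pow_mul]
    dsimp only
    linear_combination (∑ l ∈ range (p ^ w), (X ^ p ^ r : ℤ[X]) ^ l) * h2 -
      (∑ l ∈ range u, (X ^ p ^ r : ℤ[X]) ^ l) * h1
  · simp [eval_finsetSum]; ring
  · simpa [eval_finsetSum] using fun h => hu (by exact_mod_cast h)

theorem cyclotomic_dvd_of_complex_root {n : ℕ} (hn : 0 < n) {ζ : ℂ} (hζ : IsPrimitiveRoot ζ n)
    {f : ℤ[X]} (hf : aeval ζ f = 0) : cyclotomic n ℤ ∣ f := by
  rw [cyclotomic_eq_minpoly hζ hn]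
  exact minpoly.isIntegrallyClosed_dvd (hζ.isIntegral hn) hf

end Polynomials

/-! ### The local ring of ℚ[X] at a cyclotomic polynomial. -/

section Localization

open Polynomial Finset

instance cyclotomic_span_isPrime (n : ℕ) [NeZero n] :
    (Ideal.span {cyclotomic n ℚ}).IsPrime :=
  (Ideal.span_singleton_prime (cyclotomic_ne_zero n ℚ)).mpr
    (cyclotomic.irreducible_rat (NeZero.pos n)).prime

/-- The rational functions without pole at the primitive `n`-th roots of unity. -/
abbrev CyclotomicLocalization (n : ℕ) [NeZero n] : Type :=
  Localization.AtPrime (Ideal.span {cyclotomic n ℚ})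

theorem cyclotomic_rat_dvd_X_pow_sub_one_iff (n m : ℕ) [NeZero n] :
    cyclotomic n ℚ ∣ X ^ m - 1 ↔ n ∣ m := by
  constructor
  · rintro ⟨g, hg⟩
    have hζ := Complex.isPrimitiveRoot_exp n (NeZero.ne n)
    have h1 : aeval (Complex.exp (2 * Real.pi * Complex.I / n)) (cyclotomic n ℚ) = 0 := by
      have := (isRoot_cyclotomic_iff (R := ℂ)).mpr hζ
      rw [aeval_def, eval₂_eq_eval_map, map_cyclotomic]
      exact this
    have h2 := congrArg (aeval (Complex.exp (2 * Real.pi * Complex.I / n))) hg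
    rw [map_mul, h1, zero_mul] at h2
    refine hζ.dvd_of_pow_eq_one m ?_
    simpa [sub_eq_zero] using h2
  · rintro ⟨e, rfl⟩
    refine (cyclotomic.dvd_X_pow_sub_one n ℚ).trans ?_
    rw [pow_mul]
    simpa using sub_dvd_pow_sub_pow ((X : ℚ[X]) ^ n) 1 e

theorem residue_algebraMap_eq_zero_iff (n : ℕ) [NeZero n] (f : ℚ[X]) :
    IsLocalRing.residue (CyclotomicLocalization n) (algebraMap ℚ[X] _ f) = 0 ↔
      cyclotomic n ℚ ∣ f := by
  rw [IsLocalRing.residue_eq_zero_iff,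
    IsLocalization.AtPrime.to_map_mem_maximal_iff _ (Ideal.span {cyclotomic n ℚ}),
    Ideal.mem_span_singleton]

theorem isRootDeformation_cyclotomicLocalization (M : ℕ) :
    IsRootDeformation (IsLocalRing.residue (CyclotomicLocalization (2 * M + 1)))
      (algebraMap ℚ[X] _ (cyclotomic (2 * M + 1) ℚ)) (algebraMap ℚ[X] _ X) M where
  isUnit x hx := by
    by_contra h
    exact hx ((IsLocalRing.residue_eq_zero_iff x).mpr ((IsLocalRing.mem_maximalIdeal x).mpr h))
  dvd x hx := by
    rw [IsLocalRing.residue_eq_zero_iff,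
      ← IsLocalization.AtPrime.map_eq_maximalIdeal (Ideal.span {cyclotomic (2 * M + 1) ℚ}),
      Ideal.map_span, Set.image_singleton, Ideal.mem_span_singleton] at hx
    exact hx
  primitive := by
    have key : ∀ m, IsLocalRing.residue (CyclotomicLocalization (2 * M + 1))
        (algebraMap ℚ[X] _ X) ^ m = 1 ↔ 2 * M + 1 ∣ m := by
      intro m
      rw [← cyclotomic_rat_dvd_X_pow_sub_one_iff, ← residue_algebraMap_eq_zero_iff]
      simp only [map_sub, map_pow, map_one, sub_eq_zero]
    exact ⟨(key _).mpr dvd_rfl, fun m hm => (key m).mp hm⟩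
  pow_ne_one j h := by
    rw [← map_pow] at h
    have h1 := IsLocalization.injective (CyclotomicLocalization (2 * M + 1))
      (Ideal.primeCompl_le_nonZeroDivisors (Ideal.span {cyclotomic (2 * M + 1) ℚ})) (h.trans (map_one _).symm)
    have := congrArg (eval 0) h1
    simp at this

/-- Denominators in the localization are prime to Φ_n, so divisibility descends to ℚ[X]; as Φ_n is
monic, it descends further to ℤ[X]. -/
theorem pow_cyclotomic_dvd_of_dvd_localization (n e : ℕ) [NeZero n] (f : ℤ[X])
    (h : (algebraMap ℚ[X] (CyclotomicLocalization n) (cyclotomic n ℚ)) ^ e ∣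
      algebraMap ℚ[X] (CyclotomicLocalization n) (f.map (Int.castRingHom ℚ))) :
    cyclotomic n ℤ ^ e ∣ f := by
  rw [← map_dvd_map (Int.castRingHom ℚ) Int.cast_injective ((cyclotomic.monic n ℤ).pow e),
    Polynomial.map_pow, map_cyclotomic]
  obtain ⟨x, hx⟩ := h
  obtain ⟨⟨a, s⟩, ha⟩ := IsLocalization.surj (Ideal.span {cyclotomic n ℚ}).primeCompl x
  have h1 : f.map (Int.castRingHom ℚ) * s = cyclotomic n ℚ ^ e * a := by
    refine IsLocalization.injective (CyclotomicLocalization n)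
      (Ideal.primeCompl_le_nonZeroDivisors (Ideal.span {cyclotomic n ℚ})) ?_
    rw [map_mul, map_mul, hx, mul_assoc, ha, map_pow]
  refine (cyclotomic.irreducible_rat (NeZero.pos n)).prime.pow_dvd_of_dvd_mul_right e ?_
    ⟨a, h1⟩
  exact fun hd => s.2 (Ideal.mem_span_singleton.mpr hd)

end Localization

/-! ### Cyclotomic divisibility of the q-analogue. -/

section Final

open Polynomial Finset

/-- The `q`-analogue of the double sum, up to a normalising factor. -/
noncomputable def doubleSumPoly (n : ℕ) : ℤ[X] :=
  ∑ i ∈ range n, ∑ j ∈ range (n - i),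
    ((∑ l ∈ range (4 * i + 1), X ^ l) * scaledRatio n i ^ 4) *
      ((∑ l ∈ range (4 * j + 1), X ^ l) * scaledRatio n j ^ 4)

/-- The `q`-analogue of the right-hand side, with the denominators `U j` cleared. -/
noncomputable def doubleSumTarget (M : ℕ) (P U : ℕ → ℤ[X]) : ℤ[X] :=
  scaledRatio (2 * M + 1) 0 ^ 8 * (∑ l ∈ range (2 * M + 1), X ^ l) ^ 2 *
    ((∏ j ∈ range M, U j) ^ 2 -
      2 * ∑ j ∈ range M, X ^ (2 * j + 2) * (P j * ∏ i ∈ (range M).erase j, U i) ^ 2)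

theorem one_sub_sq_mul_doubleSumPoly (n : ℕ) :
    (1 - X) ^ 2 * doubleSumPoly n = ∑ i ∈ range n, ∑ j ∈ range (n - i),
      ((1 - X ^ (4 * i + 1)) * scaledRatio n i ^ 4) *
        ((1 - X ^ (4 * j + 1)) * scaledRatio n j ^ 4) := by
  have h : ∀ m : ℕ, 1 - (X : ℤ[X]) ^ m = (1 - X) * ∑ l ∈ range m, X ^ l := fun m =>
    (mul_neg_geom_sum X m).symm
  rw [doubleSumPoly, mul_sum]
  refine sum_congr rfl fun i _ => ?_
  rw [mul_sum]
  refine sum_congr rfl fun j _ => ?_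
  rw [h (4 * i + 1), h (4 * j + 1)]
  ring

theorem cyclotomic_dvd_doubleSumPoly (M L : ℕ) (hM : 0 < M) :
    cyclotomic (2 * M + 1) ℤ ∣ doubleSumPoly ((2 * M + 1) * L) := by
  have hζ := Complex.isPrimitiveRoot_exp (2 * M + 1) (by omega)
  generalize Complex.exp _ = ζ at hζ
  refine cyclotomic_dvd_of_complex_root (by omega) hζ ?_
  have h1 := double_sum_root_of_unity_eq_zero hζ L
    (fun j => aeval ζ (scaledRatio ((2 * M + 1) * L) j)) (fun j hj => by
      simpa using congrArg (aeval ζ) (scaledRatio_succ hj))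
  have h2 := congrArg (aeval ζ) (one_sub_sq_mul_doubleSumPoly ((2 * M + 1) * L))
  simp only [map_mul, map_pow, map_sub, map_one, aeval_X, map_sum] at h2
  rw [h1] at h2
  have h3 := one_sub_pow_ne_zero_of_lt hζ one_pos (by omega)
  rw [pow_one] at h3
  exact (mul_eq_zero.mp h2).resolve_left (pow_ne_zero 2 h3)

theorem cyclotomic_pow_five_dvd (M : ℕ) (hM : 0 < M) (P U : ℕ → ℤ[X])
    (hPU : ∀ j < M, P j * (1 - X ^ (2 * j + 2)) = (1 - X ^ (2 * M + 1)) * U j) :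
    cyclotomic (2 * M + 1) ℤ ^ 5 ∣ X ^ (2 * M) * (∏ j ∈ range M, U j) ^ 2 *
      doubleSumPoly (2 * M + 1) - doubleSumTarget M P U := by
  refine pow_cyclotomic_dvd_of_dvd_localization _ _ _ ?_
  have H := isRootDeformation_cyclotomicLocalization M
  set ψ : ℤ[X] →+* CyclotomicLocalization (2 * M + 1) :=
    (algebraMap ℚ[X] (CyclotomicLocalization (2 * M + 1))).comp
      (mapRingHom (Int.castRingHom ℚ)) with hψ
  have hψX : algebraMap ℚ[X] (CyclotomicLocalization (2 * M + 1)) X = ψ X := by simp [hψ]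
  rw [hψX] at H
  have : CharZero (IsLocalRing.ResidueField (CyclotomicLocalization (2 * M + 1))) :=
    algebraRat.charZero _
  change _ ∣ ψ _
  generalize algebraMap ℚ[X] (CyclotomicLocalization (2 * M + 1)) (cyclotomic (2 * M + 1) ℚ) = π at *
  have hunit : ∀ j < M, IsUnit (1 - ψ X ^ (2 * j + 2)) := fun j hj =>
    H.isUnit_one_sub (by omega) (by omega)
  have hunit1 : IsUnit (1 - ψ X) := by
    simpa using H.isUnit_one_sub (j := 1) one_pos (by omega)
  set h : ℕ → CyclotomicLocalization (2 * M + 1) := fun j =>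
    ψ X ^ (2 * j + 2) * Ring.inverse (1 - ψ X ^ (2 * j + 2)) ^ 2 with h_def
  have hh : ∀ j < M, h j * (1 - ψ X ^ (2 * j + 2)) ^ 2 = ψ X ^ (2 * j + 2) := fun j hj => by
    simp only [h_def]
    rw [mul_assoc, ← mul_pow, Ring.inverse_mul_cancel _ (hunit j hj), one_pow, mul_one]
  have key := H.dvd_double_sum (b := fun j => ψ (scaledRatio (2 * M + 1) j)) (fun j hj => by
    simpa using congrArg ψ (scaledRatio_succ (n := 2 * M + 1) (k := j) (by omega))) hh
  have hS := congrArg ψ (one_sub_sq_mul_doubleSumPoly (2 * M + 1))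
  simp only [map_mul, map_pow, map_sub, map_one, map_sum] at hS
  rw [← hS] at key
  have hgeom : (1 - ψ X) * ψ (∑ l ∈ range (2 * M + 1), X ^ l) = 1 - ψ X ^ (2 * M + 1) := by
    rw [← map_one ψ, ← map_sub, ← map_mul, mul_neg_geom_sum, map_sub, map_pow]
  -- Up to sign P j / U j is t/(1 - q^(2j+2)), so its square times q^(2j+2) is t² h j.
  have hterm : ∀ j ∈ range M, ψ X ^ (2 * j + 2) *
      (ψ (P j) * ∏ i ∈ (range M).erase j, ψ (U i)) ^ 2 =
      (ψ X ^ (2 * M + 1) - 1) ^ 2 * (∏ i ∈ range M, ψ (U i)) ^ 2 * h j := by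
    intro j hj
    have h1 := congrArg ψ (hPU j (mem_range.mp hj))
    simp only [map_mul, map_pow, map_sub, map_one] at h1
    rw [← mul_prod_erase _ _ hj, ← hh j (mem_range.mp hj)]
    generalize ∏ i ∈ (range M).erase j, ψ (U i) = V
    have h2 : (ψ (P j) * (1 - ψ X ^ (2 * j + 2))) ^ 2 =
      ((1 - ψ X ^ (2 * M + 1)) * ψ (U j)) ^ 2 := by rw [h1]
    linear_combination (h j * V ^ 2) * h2
  -- The unit (1-q)² turns the q-integers 1 + q + ⋯ into differences 1 - q^m, matching `key`.
  rw [← (hunit1.pow 2).dvd_mul_left]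
  have hfin : (1 - ψ X) ^ 2 * ψ (X ^ (2 * M) * (∏ j ∈ range M, U j) ^ 2 *
      doubleSumPoly (2 * M + 1) - doubleSumTarget M P U) =
      (∏ j ∈ range M, ψ (U j)) ^ 2 *
      (ψ X ^ (2 * M) * ((1 - ψ X) ^ 2 * ψ (doubleSumPoly (2 * M + 1))) -
      ψ (scaledRatio (2 * M + 1) 0) ^ 8 * (ψ X ^ (2 * M + 1) - 1) ^ 2 *
        (1 - 2 * (ψ X ^ (2 * M + 1) - 1) ^ 2 * ∑ j ∈ range M, h j)) := by
    have e : ψ (doubleSumTarget M P U) = ψ (scaledRatio (2 * M + 1) 0) ^ 8 *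
        ψ (∑ l ∈ range (2 * M + 1), X ^ l) ^ 2 * ((∏ j ∈ range M, ψ (U j)) ^ 2 -
          2 * ∑ j ∈ range M, ψ X ^ (2 * j + 2) *
            (ψ (P j) * ∏ i ∈ (range M).erase j, ψ (U i)) ^ 2) := by
      rw [doubleSumTarget]
      have hψ2 : ψ 2 = 2 := map_ofNat ψ 2
      simp only [map_mul, map_pow, map_sub, map_sum, map_prod, hψ2]
    rw [map_sub, e, sum_congr rfl hterm, ← mul_sum]
    simp only [map_mul, map_pow, map_prod]
    generalize ψ (∑ l ∈ range (2 * M + 1), X ^ l) = G at *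
    generalize ∑ j ∈ range M, h j = s at *
    generalize ∏ j ∈ range M, ψ (U j) = V at *
    have hg2 : ((1 - ψ X) * G) ^ 2 = (1 - ψ X ^ (2 * M + 1)) ^ 2 := by rw [hgeom]
    linear_combination (-ψ (scaledRatio (2 * M + 1) 0) ^ 8 *
      (V ^ 2 - 2 * ((ψ X ^ (2 * M + 1) - 1) ^ 2 * V ^ 2 * s))) * hg2
  rw [hfin]
  exact key.mul_left _

theorem cyclotomic_dvd_geom_sum_of_dvd {d n : ℕ} (hd : d ∣ n) (h1 : d ≠ 1) (hn : 0 < n) :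
    cyclotomic d ℤ ∣ ∑ l ∈ range n, X ^ l := by
  rw [← prod_cyclotomic_eq_geom_sum hn ℤ]
  exact dvd_prod_of_mem _ (mem_erase.mpr ⟨h1, Nat.mem_divisors.mpr ⟨hd, hn.ne'⟩⟩)

/-- Distinct cyclotomic polynomials are coprime over ℚ but not over ℤ in general; monicity brings
the product divisibility back to ℤ[X]. -/
theorem prod_cyclotomic_dvd {p s : ℕ} (hp : p.Prime) {f : ℤ[X]}
    (h1 : ∀ r < s, cyclotomic (p ^ (r + 1)) ℤ ∣ f)
    (h2 : cyclotomic (p ^ (s + 1)) ℤ ^ 5 ∣ f) :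
    (∏ r ∈ range s, cyclotomic (p ^ (r + 1)) ℤ) * cyclotomic (p ^ (s + 1)) ℤ ^ 5 ∣ f := by
  have hinj : Function.Injective (Int.castRingHom ℚ) := Int.cast_injective
  have hm : ∀ r ∈ range s, (cyclotomic (p ^ (r + 1)) ℤ).Monic := fun r _ => cyclotomic.monic _ _
  have hcop : ∀ r r', r ≠ r' →
      IsCoprime (cyclotomic (p ^ (r + 1)) ℚ) (cyclotomic (p ^ (r' + 1)) ℚ) := fun r r' h =>
    cyclotomic.isCoprime_rat fun h' => h (by simpa using Nat.pow_right_injective hp.two_le h')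
  rw [← map_dvd_map (Int.castRingHom ℚ) hinj
    ((monic_prod_of_monic _ _ hm).mul ((cyclotomic.monic _ ℤ).pow 5)), Polynomial.map_mul,
    Polynomial.map_pow, Polynomial.map_prod]
  simp only [map_cyclotomic]
  refine IsCoprime.mul_dvd ?_ ?_ ?_
  · exact IsCoprime.prod_left fun r hr =>
      (hcop r s (mem_range.mp hr).ne).pow_right
  · refine Finset.prod_dvd_of_coprime (fun r _ r' _ h => hcop r r' h) fun r hr => ?_
    rw [← map_cyclotomic _ (Int.castRingHom ℚ)]
    exact (Polynomial.map_dvd (Int.castRingHom ℚ) (h1 r (mem_range.mp hr)))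
  · rw [← map_cyclotomic _ (Int.castRingHom ℚ), ← Polynomial.map_pow]
    exact Polynomial.map_dvd (Int.castRingHom ℚ) h2

theorem prime_pow_dvd_eval_one {p s : ℕ} (hp : p.Prime) {f : ℤ[X]}
    (h1 : ∀ r < s, cyclotomic (p ^ (r + 1)) ℤ ∣ f)
    (h2 : cyclotomic (p ^ (s + 1)) ℤ ^ 5 ∣ f) : (p : ℤ) ^ (s + 5) ∣ f.eval 1 := by
  have := Fact.mk hp
  have h := eval_dvd (x := (1 : ℤ)) (prod_cyclotomic_dvd hp h1 h2)
  rw [eval_mul, eval_pow, eval_prod] at h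
  simpa [eval_one_cyclotomic_prime_pow, ← pow_add] using h

/-! ### Specialisation at q = 1. -/

theorem shiftedFactorial_half_div (k : ℕ) :
    shiftedFactorial (1 / 2) k / shiftedFactorial 1 k = Nat.centralBinom k / 4 ^ k := by
  have h1 : ∀ x : ℚ, ∀ k, shiftedFactorial x (k + 1) = shiftedFactorial x k * (x + k) := by
    intro x k
    rw [shiftedFactorial, ascPochhammer_succ_eval, ← shiftedFactorial]
  have h2 : ∀ k, shiftedFactorial 1 k ≠ 0 := fun k => by
    rw [shiftedFactorial, ascPochhammer_eval_one]; positivity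
  induction k with
  | zero => simp [shiftedFactorial]
  | succ k ih =>
    have h3 : ((k : ℚ) + 1) * Nat.centralBinom (k + 1) = 2 * (2 * k + 1) * Nat.centralBinom k := by
      exact_mod_cast Nat.succ_mul_centralBinom_succ k
    have h4 := h2 k
    have h5 : (1 : ℚ) + k ≠ 0 := by positivity
    rw [h1, h1, mul_div_mul_comm, ih, pow_succ]
    field_simp
    linear_combination (-2 : ℚ) * h3

theorem ratModEq_of_mul_eq {m : ℕ} {x y : ℚ} {D N : ℤ} (hD : IsCoprime (m : ℤ) D)
    (h : (x - y) * D = N) (hN : (m : ℤ) ∣ N) : RatModEq m x y := by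
  refine hD.dvd_of_dvd_mul_right ?_
  have h1 : (x - y).num * D = N * (x - y).den := by
    have h2 : (((x - y).num : ℚ)) = (x - y) * (x - y).den := (Rat.mul_den_eq_num _).symm
    have : (((x - y).num * D : ℤ) : ℚ) = ((N * (x - y).den : ℤ) : ℚ) := by
      push_cast
      rw [h2, ← h]; ring
    exact_mod_cast this
  rw [h1]
  exact hN.mul_right _

theorem sum_filter_add_le_eq (n : ℕ) (g : ℕ × ℕ → ℚ) :
    ∑ ij ∈ (range n ×ˢ range n).filter (fun ij : ℕ × ℕ => ij.1 + ij.2 ≤ n - 1), g ij =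
      ∑ i ∈ range n, ∑ j ∈ range (n - i), g (i, j) := by
  rw [sum_filter, sum_product]
  refine sum_congr rfl fun i hi => ?_
  rw [← sum_filter]
  refine sum_congr ?_ fun _ _ => rfl
  ext j
  have := mem_range.mp hi
  simp only [mem_filter, mem_range]
  omega

theorem eval_one_scaledRatio_eq {n k : ℕ} (h : k < n) :
    (((scaledRatio n k).eval 1 : ℤ) : ℚ) =
      4 ^ (n - 1) * (shiftedFactorial (1 / 2) k / shiftedFactorial 1 k) := by
  obtain ⟨w, rfl⟩ := Nat.exists_eq_add_of_le (Nat.succ_le_of_lt h)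
  rw [eval_one_scaledRatio, shiftedFactorial_half_div, show k.succ + w - (k + 1) = w by omega,
    show k.succ + w - 1 = k + w by omega, pow_add]
  push_cast
  field_simp

theorem eval_one_doubleSumPoly (n : ℕ) :
    (((doubleSumPoly n).eval 1 : ℤ) : ℚ) = (4 ^ (n - 1)) ^ 8 *
      ∑ ij ∈ (range n ×ˢ range n).filter (fun ij : ℕ × ℕ => ij.1 + ij.2 ≤ n - 1),
        (4 * (ij.1 : ℚ) + 1) * (4 * (ij.2 : ℚ) + 1) *
          ((shiftedFactorial (1 / 2) ij.1 ^ 4 * shiftedFactorial (1 / 2) ij.2 ^ 4) /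
            (shiftedFactorial 1 ij.1 ^ 4 * shiftedFactorial 1 ij.2 ^ 4)) := by
  rw [sum_filter_add_le_eq, doubleSumPoly, eval_finsetSum, Int.cast_sum, mul_sum]
  refine sum_congr rfl fun i hi => ?_
  rw [eval_finsetSum, Int.cast_sum, mul_sum]
  refine sum_congr rfl fun j hj => ?_
  have hi := mem_range.mp hi
  have hj := mem_range.mp hj
  have hg : ∀ m : ℕ, (∑ l ∈ range m, (X : ℤ[X]) ^ l).eval 1 = m := fun m => by
    simp [eval_finsetSum]
  simp only [eval_mul, eval_pow, hg, Int.cast_mul, Int.cast_pow]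
  rw [eval_one_scaledRatio_eq hi, eval_one_scaledRatio_eq (show j < n by omega), mul_pow, mul_pow,
    div_pow, div_pow, ← div_mul_div_comm]
  push_cast
  ring

theorem eval_one_doubleSumTarget (M : ℕ) (P U : ℕ → ℤ[X])
    (hPU : ∀ j < M, (P j).eval 1 * (2 * j + 2) = (2 * M + 1) * (U j).eval 1) :
    (((doubleSumTarget M P U).eval 1 : ℤ) : ℚ) = (4 ^ (2 * M)) ^ 8 *
      (∏ j ∈ range M, (((U j).eval 1 : ℤ) : ℚ)) ^ 2 *
        ((2 * M + 1) ^ 2 - (2 * M + 1) ^ 4 / 2 * harmonicTwo M) := by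
  have hH : harmonicTwo M = ∑ j ∈ range M, 1 / ((j : ℚ) + 1) ^ 2 := by
    rw [harmonicTwo]
    clear hPU
    induction M with
    | zero => simp
    | succ M ih => rw [sum_Icc_succ_top (by omega), ih, sum_range_succ]; push_cast; rfl
  have hterm : ∀ j ∈ range M, ((((P j).eval 1 : ℤ) : ℚ) *
      ∏ i ∈ (range M).erase j, (((U i).eval 1 : ℤ) : ℚ)) ^ 2 =
      (2 * M + 1) ^ 2 / 4 * (∏ i ∈ range M, (((U i).eval 1 : ℤ) : ℚ)) ^ 2 *
        (1 / ((j : ℚ) + 1) ^ 2) := by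
    intro j hj
    have h1 : (((P j).eval 1 : ℤ) : ℚ) * (2 * j + 2) = (2 * M + 1) * (((U j).eval 1 : ℤ) : ℚ) := by
      exact_mod_cast hPU j (mem_range.mp hj)
    have h2 : (j : ℚ) + 1 ≠ 0 := by positivity
    rw [← mul_prod_erase _ _ hj]
    generalize ∏ i ∈ (range M).erase j, (((U i).eval 1 : ℤ) : ℚ) = V
    have h3 : (((U j).eval 1 : ℤ) : ℚ) * (2 * M + 1) = 2 * (((P j).eval 1 : ℤ) : ℚ) * (j + 1) := by
      linear_combination -h1
    have h4 : (2 * (M : ℚ) + 1) ^ 2 / 4 * ((((U j).eval 1 : ℤ) : ℚ) * V) ^ 2 *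
        (1 / ((j : ℚ) + 1) ^ 2) =
        ((((U j).eval 1 : ℤ) : ℚ) * (2 * M + 1)) ^ 2 * V ^ 2 / (4 * ((j : ℚ) + 1) ^ 2) := by
      field_simp
    rw [h4, h3]
    field_simp
    ring
  have hg : (∑ l ∈ range (2 * M + 1), (X : ℤ[X]) ^ l).eval 1 = 2 * M + 1 := by
    simp [eval_finsetSum]
  have h0 : (((scaledRatio (2 * M + 1) 0).eval 1 : ℤ) : ℚ) = 4 ^ (2 * M) := by
    rw [eval_one_scaledRatio]; simp
  rw [doubleSumTarget]
  rw [eval_mul, eval_mul, eval_pow (n := 2), hg]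
  simp only [eval_mul, eval_pow, eval_sub, eval_finsetSum, eval_prod, eval_X, eval_ofNat, one_pow,
    one_mul]
  push_cast
  rw [h0, sum_congr rfl hterm, ← mul_sum, ← hH]
  ring

end Final

theorem mainTheorem9 (p : ℕ) (hp : p.Prime) (hp3 : 3 < p) (s : ℕ) (hs : 1 ≤ s) :
    RatModEq (p ^ (s + 4))
      (∑ ij ∈ (Finset.range (p ^ s) ×ˢ Finset.range (p ^ s)).filter
          (fun ij : ℕ × ℕ => ij.1 + ij.2 ≤ p ^ s - 1),
        (4 * (ij.1 : ℚ) + 1) * (4 * (ij.2 : ℚ) + 1) *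
          ((shiftedFactorial (1 / 2) ij.1 ^ 4 * shiftedFactorial (1 / 2) ij.2 ^ 4) /
            (shiftedFactorial 1 ij.1 ^ 4 * shiftedFactorial 1 ij.2 ^ 4)))
      ((p : ℚ) ^ (2 * s) - (p : ℚ) ^ (4 * s) / 2 * harmonicTwo ((p ^ s - 1) / 2)) := by
  -- After the shift the length is p^(s+1): s lower cyclotomic factors and one fifth power give
  -- p^(s+5), the required modulus.
  obtain ⟨s, rfl⟩ : ∃ s', s = s' + 1 := ⟨s - 1, by omega⟩
  have hodd : Odd p := hp.odd_of_ne_two (by omega)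
  obtain ⟨M, hM⟩ : Odd (p ^ (s + 1)) := hodd.pow
  have hM0 : 0 < M := by
    have : p ^ 1 ≤ p ^ (s + 1) := Nat.pow_le_pow_right hp.pos (by omega)
    rw [pow_one] at this
    omega
  have hex : ∀ j < M, ∃ PU : Polynomial ℤ × Polynomial ℤ,
      PU.1 * (1 - Polynomial.X ^ (2 * j + 2)) = (1 - Polynomial.X ^ (p ^ (s + 1))) * PU.2 ∧
      PU.1.eval 1 * ((2 * j + 2 : ℕ) : ℤ) = (p : ℤ) ^ (s + 1) * PU.2.eval 1 ∧
      ¬ (p : ℤ) ∣ PU.2.eval 1 :=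
    fun j hj => exists_quotient_of_pow_sub_one hp (by omega) (by omega)
  choose! PU hPU1 hPU2 hPU3 using hex
  have hMc : (p : ℤ) ^ (s + 1) = 2 * M + 1 := by exact_mod_cast hM
  have hMq : (p : ℚ) ^ (s + 1) = 2 * M + 1 := by exact_mod_cast hM
  have hdvd := prime_pow_dvd_eval_one (s := s) hp
    (f := Polynomial.X ^ (2 * M) * (∏ j ∈ Finset.range M, (PU j).2) ^ 2 *
      doubleSumPoly (2 * M + 1) - doubleSumTarget M (fun j => (PU j).1) (fun j => (PU j).2))
    (fun r hr => by
      obtain ⟨M', hM'⟩ : Odd (p ^ (r + 1)) := hodd.pow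
      have hM'0 : 0 < M' := by
        have : p ^ 1 ≤ p ^ (r + 1) := Nat.pow_le_pow_right hp.pos (by omega)
        rw [pow_one] at this
        omega
      obtain ⟨L, hL⟩ : p ^ (r + 1) ∣ p ^ (s + 1) := pow_dvd_pow p (by omega)
      -- For lower orders both sides vanish separately; the target does so through the q-integer of
      -- length p^(s+1).
      refine dvd_sub (Dvd.dvd.mul_left ?_ _) ?_
      · rw [← hM, hL, hM']
        exact cyclotomic_dvd_doubleSumPoly M' L hM'0
      · refine Dvd.dvd.mul_right (Dvd.dvd.mul_left (Dvd.dvd.pow ?_ two_ne_zero) _) _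
        refine cyclotomic_dvd_geom_sum_of_dvd ⟨L, by rw [← hM, hL]⟩ ?_ (by omega)
        omega)
    (by
      rw [hM]
      exact cyclotomic_pow_five_dvd M hM0 _ _ fun j hj => by rw [hPU1 j hj, hM])
  rw [← Nat.cast_pow] at hdvd
  have hpi : Prime (p : ℤ) := Nat.prime_iff_prime_int.mp hp
  have hcop : IsCoprime ((p ^ (s + 1 + 4) : ℕ) : ℤ)
      ((4 ^ (2 * M)) ^ 8 * (∏ j ∈ Finset.range M, (PU j).2.eval 1) ^ 2) := by
    push_cast
    refine IsCoprime.pow_left (IsCoprime.mul_right ?_ ?_)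
    · refine IsCoprime.pow_right (IsCoprime.pow_right ?_)
      rw [hpi.coprime_iff_not_dvd]
      intro h
      have h2 : p ∣ 2 ^ 2 := by exact_mod_cast h
      have := Nat.le_of_dvd two_pos (hp.dvd_of_dvd_pow h2)
      omega
    · refine IsCoprime.pow_right (IsCoprime.prod_right fun j hj => ?_)
      rw [hpi.coprime_iff_not_dvd]
      exact hPU3 j (Finset.mem_range.mp hj)
  refine ratModEq_of_mul_eq hcop ?_ hdvd
  have e1 := eval_one_doubleSumPoly (2 * M + 1)
  have e2 := eval_one_doubleSumTarget M (fun j => (PU j).1) (fun j => (PU j).2) (fun j hj => by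
    rw [← hMc, ← hPU2 j hj]; push_cast; rfl)
  rw [Polynomial.eval_sub, Int.cast_sub, e2, Polynomial.eval_mul,
    Int.cast_mul _ (Polynomial.eval 1 (doubleSumPoly (2 * M + 1))), e1, hM,
    show 2 * M + 1 - 1 = 2 * M by omega, show 2 * M / 2 = M by omega,
    mul_comm 2 (s + 1), mul_comm 4 (s + 1), pow_mul, pow_mul, hMq]
  simp only [Polynomial.eval_mul, Polynomial.eval_pow, Polynomial.eval_prod, Polynomial.eval_X]
  push_cast
  ring
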